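/- All monoidal categories and monoidal functors below are strict. A \emph{monoidal equational theory} consists of a set $E_1$ of generators for objects, a set $E_2$ of generators for morphisms, each with a source and a target in the free monoid $E_1^*$, and a set $E_3$ of relations, each a pair of parallel morphisms of the free strict monoidal category $\mathcal{E}$ on the signature (objects: the elements of $E_1^*$; morphisms: formal composites and tensor products of generators modulo the laws of strict monoidal categories). It generates the strict monoidal category $\mathcal{E}/{\equiv}$, where $\equiv$ is the smallest congruence with respect to composition and tensor product that contains the relations. The theory is a \emph{presentation} of a strict monoidal category $\mathcal{M}$ when $\mathcal{M}$ and $\mathcal{E}/{\equiv}$ are monoidally equivalent, i.e. there are strict monoidal functors $F$ and $G$ between them in opposite directions and invertible monoidal natural transformations $\mathrm{Id}\to GF$ and $FG\to\mathrm{Id}$. The \emph{theory of bicommutative bialgebras} has one generator for objects, denoted $1$ (so that its objects are the natural numbers, with addition as tensor product), five generators for morphisms $$\mu:2\to 1,\qquad \eta:0\to 1,\qquad \delta:1\to 2,\qquad \varepsilon:1\to 0,\qquad \gamma:2\to 2,$$ and the following twenty-two relations, where $1$ also denotes the identity of the object $1$: (symmetry) $(1\otimes\gamma)\circ(\gamma\otimes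 1)\circ(1\otimes\gamma)=(\gamma\otimes 1)\circ(1\otimes\gamma)\circ(\gamma\otimes 1)$ and $\gamma\circ\gamma=\mathrm{id}_2$; (commutative monoid) $\mu\circ(\mu\otimes 1)=\mu\circ(1\otimes\mu)$, $\ \mu\circ(\eta\otimes 1)=1$, $\ \mu\circ(1\otimes\eta)=1$, $\ \gamma\circ(\mu\otimes 1)=(1\otimes\mu)\circ(\gamma\otimes 1)\circ(1\otimes\gamma)$, $\ \gamma\circ(1\otimes\mu)=(\mu\otimes 1)\circ(1\otimes\gamma)\circ(\gamma\otimes 1)$, $\ \gamma\circ(\eta\otimes 1)=1\otimes\eta$, $\ \gamma\circ(1\otimes\eta)=\eta\otimes 1$, $\ \mu\circ\gamma=\mu$; (cocommutative comonoid) $(\delta\otimes 1)\circ\delta=(1\otimes\delta)\circ\delta$, $\ (\varepsilon\otimes 1)\circ\delta=1$, $\ (1\otimes\varepsilon)\circ\delta=1$, $\ (\delta\otimes 1)\circ\gamma=(1\otimes\gamma)\circ(\gamma\otimes 1)\circ(1\otimes\delta)$, $\ (1\otimes\delta)\circ\gamma=(\gamma\otimes 1)\circ(1\otimes\gamma)\circ(\delta\otimes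 1)$, $\ (\varepsilon\otimes 1)\circ\gamma=1\otimes\varepsilon$, $\ (1\otimes\varepsilon)\circ\gamma=\varepsilon\otimes 1$, $\ \gamma\circ\delta=\delta$; (compatibility) $\delta\circ\mu=(\mu\otimes\mu)\circ(1\otimes\gamma\otimes 1)\circ(\delta\otimes\delta)$, $\ \delta\circ\eta=\eta\otimes\eta$, $\ \varepsilon\circ\mu=\varepsilon\otimes\varepsilon$, $\ \varepsilon\circ\eta=\mathrm{id}_0$. Let $\mathcal{B}$ be the free strict monoidal category on this signature and $\mathcal{B}/{\equiv}$ the category generated by the theory. Let $\mathbf{MRel}$ be the strict monoidal category whose objects are the finite ordinals $n=\{0,\dots,n-1\}$, whose morphisms $m\to n$ are the multirelations $R:m\times n\to\mathbb{N}$, with composition $(R_2\circ R_1)(a,c)=\sum_{b}R_1(a,b)\,R_2(b,c)$, and whose tensor product is the disjoint union, on objects (addition) and on morphisms (block-diagonal matrices). \textbf{Theorem.} There is an isomorphism of strict monoidal categories $\mathcal{B}/{\equiv}\;\cong\;\mathbf{MRel}$ (a strict monoidal functor with a strict monoidal inverse). It is the interpretation functor: it is the identity on objects, and it sends $\mu,\eta,\delta,\varepsilon,\gamma$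 respectively to the matrices $$\begin{pmatrix}1\\1\end{pmatrix},\qquad 0:0\to 1,\qquad \begin{pmatrix}1&1\end{pmatrix},\qquad 0:1\to 0,\qquad \begin{pmatrix}0&1\\1&0\end{pmatrix}.$$ In particular, the theory of bicommutative bialgebras is a presentation of $\mathbf{MRel}$. -/

import Mathlib

open CategoryTheory MonoidalCategory

universe u v w u₁ v₁ u₂ v₂

/-! ### Strict monoidal categories, strict monoidal functors, monoidal equivalence -/

/-- A monoidal category is strict when its associators and unitors are identities. As the types of
these morphisms involve different expressions for the same object, "identity" is expressed by
`eqToIso`, as in `CategoryTheory.Bicategory.Strict`. -/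
class StrictMonoidal (C : Type u) [Category.{v} C] [MonoidalCategory C] : Prop where
  assoc_obj : ∀ X Y Z : C, (X ⊗ Y) ⊗ Z = X ⊗ (Y ⊗ Z)
  unit_obj : ∀ X : C, 𝟙_ C ⊗ X = X
  obj_unit : ∀ X : C, X ⊗ 𝟙_ C = X
  associator_eq : ∀ X Y Z : C, α_ X Y Z = eqToIso (assoc_obj X Y Z)
  leftUnitor_eq : ∀ X : C, λ_ X = eqToIso (unit_obj X)
  rightUnitor_eq : ∀ X : C, ρ_ X = eqToIso (obj_unit X)

/-- The data of a strict tensor product on a category. -/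
structure StrictTensor (C : Type u) [Category.{v} C] where
  unit : C
  obj : C → C → C
  assoc_obj : ∀ X Y Z, obj (obj X Y) Z = obj X (obj Y Z)
  unit_obj : ∀ X, obj unit X = X
  obj_unit : ∀ X, obj X unit = X
  hom : ∀ {X₁ Y₁ X₂ Y₂ : C}, (X₁ ⟶ Y₁) → (X₂ ⟶ Y₂) → (obj X₁ X₂ ⟶ obj Y₁ Y₂)
  hom_id : ∀ X Y, hom (𝟙 X) (𝟙 Y) = 𝟙 (obj X Y)
  hom_comp : ∀ {X₁ Y₁ Z₁ X₂ Y₂ Z₂ : C} (f₁ : X₁ ⟶ Y₁) (f₂ : X₂ ⟶ Y₂)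
    (g₁ : Y₁ ⟶ Z₁) (g₂ : Y₂ ⟶ Z₂), hom f₁ f₂ ≫ hom g₁ g₂ = hom (f₁ ≫ g₁) (f₂ ≫ g₂)
  assoc_hom : ∀ {X₁ X₂ X₃ Y₁ Y₂ Y₃ : C} (f₁ : X₁ ⟶ Y₁) (f₂ : X₂ ⟶ Y₂) (f₃ : X₃ ⟶ Y₃),
    hom (hom f₁ f₂) f₃ ≫ eqToHom (assoc_obj Y₁ Y₂ Y₃) =
      eqToHom (assoc_obj X₁ X₂ X₃) ≫ hom f₁ (hom f₂ f₃)
  unit_hom : ∀ {X Y : C} (f : X ⟶ Y),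
    hom (𝟙 unit) f ≫ eqToHom (unit_obj Y) = eqToHom (unit_obj X) ≫ f
  hom_unit : ∀ {X Y : C} (f : X ⟶ Y),
    hom f (𝟙 unit) ≫ eqToHom (obj_unit Y) = eqToHom (obj_unit X) ≫ f

namespace StrictTensor

variable {C : Type u} [Category.{v} C] (T : StrictTensor C)

theorem hom_eqToHom_id {X Y : C} (h : X = Y) (Z : C) :
    T.hom (eqToHom h) (𝟙 Z) = eqToHom (by rw [h]) := by
  subst h; simp [T.hom_id]

theorem hom_id_eqToHom {X Y : C} (h : X = Y) (Z : C) :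
    T.hom (𝟙 Z) (eqToHom h) = eqToHom (by rw [h]) := by
  subst h; simp [T.hom_id]

theorem pentagon (W X Y Z : C) :
    T.hom (eqToHom (T.assoc_obj W X Y)) (𝟙 Z) ≫ eqToHom (T.assoc_obj W (T.obj X Y) Z) ≫
        T.hom (𝟙 W) (eqToHom (T.assoc_obj X Y Z)) =
      eqToHom (T.assoc_obj (T.obj W X) Y Z) ≫ eqToHom (T.assoc_obj W X (T.obj Y Z)) := by
  simp only [hom_eqToHom_id, hom_id_eqToHom, eqToHom_trans]

theorem triangle (X Y : C) :
    eqToHom (T.assoc_obj X T.unit Y) ≫ T.hom (𝟙 X) (eqToHom (T.unit_obj Y)) =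
      T.hom (eqToHom (T.obj_unit X)) (𝟙 Y) := by
  simp only [hom_eqToHom_id, hom_id_eqToHom, eqToHom_trans]

/-- The monoidal category defined by a strict tensor product. -/
abbrev monoidalCategory : MonoidalCategory C :=
  letI : MonoidalCategoryStruct C :=
    { tensorObj := T.obj
      whiskerLeft := fun X _ _ f => T.hom (𝟙 X) f
      whiskerRight := fun f Y => T.hom f (𝟙 Y)
      tensorHom := fun f g => T.hom f g
      tensorUnit := T.unit
      associator := fun X Y Z => eqToIso (T.assoc_obj X Y Z)
      leftUnitor := fun X => eqToIso (T.unit_obj X)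
      rightUnitor := fun X => eqToIso (T.obj_unit X) }
  MonoidalCategory.ofTensorHom
    (id_tensorHom_id := T.hom_id)
    (id_tensorHom := fun _ _ _ _ => rfl)
    (tensorHom_id := fun _ _ => rfl)
    (tensorHom_comp_tensorHom := T.hom_comp)
    (associator_naturality := T.assoc_hom)
    (leftUnitor_naturality := T.unit_hom)
    (rightUnitor_naturality := T.hom_unit)
    (pentagon := T.pentagon)
    (triangle := T.triangle)

theorem strictMonoidal : @StrictMonoidal C _ T.monoidalCategory :=
  letI := T.monoidalCategory
  { assoc_obj := T.assoc_obj
    unit_obj := T.unit_obj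
    obj_unit := T.obj_unit
    associator_eq := fun _ _ _ => rfl
    leftUnitor_eq := fun _ => rfl
    rightUnitor_eq := fun _ => rfl }

end StrictTensor

section StrictFunctors

variable {C : Type u} [Category.{v} C] [MonoidalCategory C]
variable {D : Type u₁} [Category.{v₁} D] [MonoidalCategory D]
variable {E : Type u₂} [Category.{v₂} E] [MonoidalCategory E]

/-- Strict monoidal functors: tensor product and unit are preserved on the nose. -/
structure IsStrictMonoidal (F : C ⥤ D) : Prop where
  unit_obj : F.obj (𝟙_ C) = 𝟙_ D
  tensor_obj : ∀ X Y : C, F.obj (X ⊗ Y) = F.obj X ⊗ F.obj Y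
  tensor_map : ∀ {X₁ Y₁ X₂ Y₂ : C} (f : X₁ ⟶ Y₁) (g : X₂ ⟶ Y₂),
    F.map (f ⊗ₘ g) =
      eqToHom (tensor_obj X₁ X₂) ≫ (F.map f ⊗ₘ F.map g) ≫ eqToHom (tensor_obj Y₁ Y₂).symm

/-- Monoidal natural transformations between strict monoidal functors: `θ_{X ⊗ Y} = θ_X ⊗ θ_Y` and
`θ_I = id_I`. -/
structure IsMonoidalTrans {F G : C ⥤ D} (hF : IsStrictMonoidal F) (hG : IsStrictMonoidal G)
    (θ : F ⟶ G) : Prop where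
  unit_app : θ.app (𝟙_ C) = eqToHom (hF.unit_obj.trans hG.unit_obj.symm)
  tensor_app : ∀ X Y : C, θ.app (X ⊗ Y) =
    eqToHom (hF.tensor_obj X Y) ≫ (θ.app X ⊗ₘ θ.app Y) ≫ eqToHom (hG.tensor_obj X Y).symm

theorem isStrictMonoidal_id : IsStrictMonoidal (𝟭 C) :=
  ⟨rfl, fun _ _ => rfl, fun _ _ => by simp⟩

theorem IsStrictMonoidal.comp {F : C ⥤ D} {G : D ⥤ E} (hF : IsStrictMonoidal F)
    (hG : IsStrictMonoidal G) : IsStrictMonoidal (F ⋙ G) where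
  unit_obj := (congrArg G.obj hF.unit_obj).trans hG.unit_obj
  tensor_obj X Y := (congrArg G.obj (hF.tensor_obj X Y)).trans (hG.tensor_obj _ _)
  tensor_map f g := by
    simp [hF.tensor_map, hG.tensor_map, eqToHom_map]

variable (C D)

/-- Monoidal equivalence of strict monoidal categories: strict monoidal functors `F` and `G` in
opposite directions, and invertible monoidal natural transformations `Id ⟶ GF` and `FG ⟶ Id`. -/
def MonoidallyEquivalent : Prop :=
  ∃ (F : C ⥤ D) (G : D ⥤ C) (hF : IsStrictMonoidal F) (hG : IsStrictMonoidal G)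
    (η : 𝟭 C ≅ F ⋙ G) (ε : G ⋙ F ≅ 𝟭 D),
    IsMonoidalTrans isStrictMonoidal_id (hF.comp hG) η.hom ∧
      IsMonoidalTrans (hG.comp hF) isStrictMonoidal_id ε.hom

end StrictFunctors

/-! ### Signatures and the free strict monoidal category on a signature -/

/-- A signature: generators `E₁` for objects and generators `E₂` for morphisms, each with a source
and a target in the free monoid on `E₁` (words in `E₁`, with concatenation). -/
structure Signature where
  E₁ : Type u
  E₂ : Type v
  s₁ : E₂ → List E₁
  t₁ : E₂ → List E₁

/-- Formal composites and tensor products of generators (`comp f g` is `g ∘ f`). -/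
inductive Signature.Term (S : Signature.{u, v}) : List S.E₁ → List S.E₁ → Type (max u v)
  | gen (x : S.E₂) : Signature.Term S (S.s₁ x) (S.t₁ x)
  | id (a : List S.E₁) : Signature.Term S a a
  | comp {a b c : List S.E₁} (f : Signature.Term S a b) (g : Signature.Term S b c) :
      Signature.Term S a c
  | tensor {a b c d : List S.E₁} (f : Signature.Term S a b) (g : Signature.Term S c d) :
      Signature.Term S (a ++ c) (b ++ d)

/-- The identity term, between two equal words. -/
def Signature.Term.ofEq {S : Signature.{u, v}} {a b : List S.E₁} (h : a = b) : S.Term a b :=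
  h ▸ Signature.Term.id a

/-- The laws of strict monoidal categories, as the least congruence on terms containing the
axioms. -/
inductive Signature.TermEq (S : Signature.{u, v}) :
    ∀ {a b : List S.E₁}, S.Term a b → S.Term a b → Prop
  | refl {a b} (f : S.Term a b) : Signature.TermEq S f f
  | symm {a b} {f g : S.Term a b} : Signature.TermEq S f g → Signature.TermEq S g f
  | trans {a b} {f g h : S.Term a b} :
      Signature.TermEq S f g → Signature.TermEq S g h → Signature.TermEq S f h
  | comp_congr {a b c} {f f' : S.Term a b} {g g' : S.Term b c} :
      Signature.TermEq S f f' → Signature.TermEq S g g' →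
        Signature.TermEq S (.comp f g) (.comp f' g')
  | tensor_congr {a b c d} {f f' : S.Term a b} {g g' : S.Term c d} :
      Signature.TermEq S f f' → Signature.TermEq S g g' →
        Signature.TermEq S (.tensor f g) (.tensor f' g')
  | id_comp {a b} (f : S.Term a b) : Signature.TermEq S (.comp (.id a) f) f
  | comp_id {a b} (f : S.Term a b) : Signature.TermEq S (.comp f (.id b)) f
  | assoc {a b c d} (f : S.Term a b) (g : S.Term b c) (h : S.Term c d) :
      Signature.TermEq S (.comp (.comp f g) h) (.comp f (.comp g h))
  | tensor_id (a b) : Signature.TermEq S (.tensor (.id a) (.id b)) (.id (a ++ b))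
  | interchange {a b c a' b' c'} (f : S.Term a b) (f' : S.Term a' b') (g : S.Term b c)
      (g' : S.Term b' c') :
      Signature.TermEq S (.comp (.tensor f f') (.tensor g g')) (.tensor (.comp f g) (.comp f' g'))
  | tensor_assoc {a b a' b' a'' b''} (f : S.Term a b) (f' : S.Term a' b') (f'' : S.Term a'' b'') :
      Signature.TermEq S
        (.comp (.tensor (.tensor f f') f'') (.ofEq (List.append_assoc b b' b'')))
        (.comp (.ofEq (List.append_assoc a a' a'')) (.tensor f (.tensor f' f'')))
  | unit_tensor {a b} (f : S.Term a b) :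
      Signature.TermEq S (.comp (.tensor (.id []) f) (.ofEq (List.nil_append b)))
        (.comp (.ofEq (List.nil_append a)) f)
  | tensor_unit {a b} (f : S.Term a b) :
      Signature.TermEq S (.comp (.tensor f (.id [])) (.ofEq (List.append_nil b)))
        (.comp (.ofEq (List.append_nil a)) f)

/-- The setoid of terms modulo the laws of strict monoidal categories. -/
def Signature.termSetoid (S : Signature.{u, v}) (a b : List S.E₁) : Setoid (S.Term a b) where
  r := Signature.TermEq S
  iseqv := ⟨.refl, .symm, .trans⟩

/-- The objects of the free strict monoidal category on a signature are the words in `E₁`. -/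
structure Signature.FreeCat (S : Signature.{u, v}) : Type u where
  word : List S.E₁

namespace Signature.FreeCat

variable {S : Signature.{u, v}}

instance category : Category.{max u v} S.FreeCat where
  Hom a b := Quotient (S.termSetoid a.word b.word)
  id a := Quotient.mk _ (.id a.word)
  comp f g := Quotient.map₂ Term.comp (fun _ _ h _ _ h' => TermEq.comp_congr h h') f g
  id_comp := by rintro a b ⟨f⟩; exact Quotient.sound (TermEq.id_comp f)
  comp_id := by rintro a b ⟨f⟩; exact Quotient.sound (TermEq.comp_id f)
  assoc := by rintro a b c d ⟨f⟩ ⟨g⟩ ⟨h⟩; exact Quotient.sound (TermEq.assoc f g h)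

/-- The morphism represented by a term. -/
def ofTerm {a b : List S.E₁} (f : S.Term a b) : (⟨a⟩ : S.FreeCat) ⟶ ⟨b⟩ := Quotient.mk _ f

theorem eqToHom_eq {a b : S.FreeCat} (h : a = b) :
    eqToHom h = ofTerm (Term.ofEq (congrArg word h)) := by
  subst h; rfl

/-- Concatenation of words and tensor product of (classes of) terms. -/
def strictTensor : StrictTensor S.FreeCat where
  unit := ⟨[]⟩
  obj a b := ⟨a.word ++ b.word⟩
  assoc_obj _ _ _ := congrArg mk (List.append_assoc _ _ _)
  unit_obj _ := congrArg mk (List.nil_append _)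
  obj_unit _ := congrArg mk (List.append_nil _)
  hom f g := Quotient.map₂ Term.tensor (fun _ _ h _ _ h' => TermEq.tensor_congr h h') f g
  hom_id a b := Quotient.sound (TermEq.tensor_id a.word b.word)
  hom_comp := by
    rintro _ _ _ _ _ _ ⟨f⟩ ⟨f'⟩ ⟨g⟩ ⟨g'⟩; exact Quotient.sound (TermEq.interchange f f' g g')
  assoc_hom := by
    rintro _ _ _ _ _ _ ⟨f⟩ ⟨f'⟩ ⟨f''⟩
    rw [eqToHom_eq, eqToHom_eq]
    exact Quotient.sound (TermEq.tensor_assoc f f' f'')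
  unit_hom := by
    rintro _ _ ⟨f⟩
    rw [eqToHom_eq, eqToHom_eq]
    exact Quotient.sound (TermEq.unit_tensor f)
  hom_unit := by
    rintro _ _ ⟨f⟩
    rw [eqToHom_eq, eqToHom_eq]
    exact Quotient.sound (TermEq.tensor_unit f)

instance monoidalCategory : MonoidalCategory S.FreeCat := strictTensor.monoidalCategory

instance strictMonoidal : StrictMonoidal S.FreeCat := strictTensor.strictMonoidal

end Signature.FreeCat

/-- A generator, as a morphism of the free strict monoidal category. -/
def Signature.gen (S : Signature.{u, v}) (x : S.E₂) : (⟨S.s₁ x⟩ : S.FreeCat) ⟶ ⟨S.t₁ x⟩ :=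
  Signature.FreeCat.ofTerm (Signature.Term.gen x)

/-! ### Monoidal equational theories and the categories they generate -/

/-- A monoidal equational theory: a signature together with a set `E₃` of relations, each being a
pair of parallel morphisms of the free strict monoidal category on the signature. -/
structure EqTheory extends Signature.{u, v} where
  E₃ : Type w
  src : E₃ → toSignature.FreeCat
  tgt : E₃ → toSignature.FreeCat
  s₂ : ∀ e : E₃, src e ⟶ tgt e
  t₂ : ∀ e : E₃, src e ⟶ tgt e

namespace EqTheory

/-- The smallest congruence, with respect to composition and tensor product, that contains the
relations of the theory. -/
inductive Congruence (E : EqTheory.{u, v, w}) :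
    ∀ {a b : E.toSignature.FreeCat}, (a ⟶ b) → (a ⟶ b) → Prop
  | rel (e : E.E₃) : Congruence E (E.s₂ e) (E.t₂ e)
  | refl {a b : E.toSignature.FreeCat} (f : a ⟶ b) : Congruence E f f
  | symm {a b : E.toSignature.FreeCat} {f g : a ⟶ b} : Congruence E f g → Congruence E g f
  | trans {a b : E.toSignature.FreeCat} {f g h : a ⟶ b} :
      Congruence E f g → Congruence E g h → Congruence E f h
  | comp {a b c : E.toSignature.FreeCat} {f f' : a ⟶ b} {g g' : b ⟶ c} :
      Congruence E f f' → Congruence E g g' → Congruence E (f ≫ g) (f' ≫ g')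
  | tensor {a b c d : E.toSignature.FreeCat} {f f' : a ⟶ b} {g g' : c ⟶ d} :
      Congruence E f f' → Congruence E g g' → Congruence E (f ⊗ₘ g) (f' ⊗ₘ g')

/-- The setoid of morphisms modulo the relations of the theory. -/
def homSetoid (E : EqTheory.{u, v, w}) (a b : E.toSignature.FreeCat) : Setoid (a ⟶ b) where
  r := Congruence E
  iseqv := ⟨.refl, .symm, .trans⟩

/-- The objects of the category generated by a theory are those of the free strict monoidal
category on its signature. -/
structure Cat (E : EqTheory.{u, v, w}) : Type u where
  as : E.toSignature.FreeCat

namespace Cat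

variable {E : EqTheory.{u, v, w}}

instance category : Category.{max u v} E.Cat where
  Hom a b := Quotient (E.homSetoid a.as b.as)
  id a := Quotient.mk _ (𝟙 a.as)
  comp f g := Quotient.map₂ (fun f g => f ≫ g) (fun _ _ h _ _ h' => Congruence.comp h h') f g
  id_comp := by rintro a b ⟨f⟩; exact congrArg (Quotient.mk _) (Category.id_comp f)
  comp_id := by rintro a b ⟨f⟩; exact congrArg (Quotient.mk _) (Category.comp_id f)
  assoc := by
    rintro a b c d ⟨f⟩ ⟨g⟩ ⟨h⟩; exact congrArg (Quotient.mk _) (Category.assoc f g h)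

/-- The class of a morphism modulo the relations of the theory. -/
def ofHom {a b : E.toSignature.FreeCat} (f : a ⟶ b) : (⟨a⟩ : E.Cat) ⟶ ⟨b⟩ := Quotient.mk _ f

theorem eqToHom_eq {a b : E.Cat} (h : a = b) :
    eqToHom h = ofHom (eqToHom (congrArg as h)) := by
  subst h; rfl

/-- The tensor product induced on the quotient. -/
def strictTensor : StrictTensor E.Cat where
  unit := ⟨𝟙_ E.toSignature.FreeCat⟩
  obj a b := ⟨a.as ⊗ b.as⟩
  assoc_obj _ _ _ := congrArg mk (StrictMonoidal.assoc_obj _ _ _)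
  unit_obj _ := congrArg mk (StrictMonoidal.unit_obj _)
  obj_unit _ := congrArg mk (StrictMonoidal.obj_unit _)
  hom f g := Quotient.map₂ (fun f g => f ⊗ₘ g) (fun _ _ h _ _ h' => Congruence.tensor h h') f g
  hom_id a b := congrArg (Quotient.mk _) (Signature.FreeCat.strictTensor.hom_id a.as b.as)
  hom_comp := by
    rintro _ _ _ _ _ _ ⟨f⟩ ⟨f'⟩ ⟨g⟩ ⟨g'⟩
    exact congrArg (Quotient.mk _) (Signature.FreeCat.strictTensor.hom_comp f f' g g')
  assoc_hom := by
    rintro _ _ _ _ _ _ ⟨f⟩ ⟨f'⟩ ⟨f''⟩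
    rw [eqToHom_eq, eqToHom_eq]
    exact congrArg (Quotient.mk _) (Signature.FreeCat.strictTensor.assoc_hom f f' f'')
  unit_hom := by
    rintro _ _ ⟨f⟩
    rw [eqToHom_eq, eqToHom_eq]
    exact congrArg (Quotient.mk _) (Signature.FreeCat.strictTensor.unit_hom f)
  hom_unit := by
    rintro _ _ ⟨f⟩
    rw [eqToHom_eq, eqToHom_eq]
    exact congrArg (Quotient.mk _) (Signature.FreeCat.strictTensor.hom_unit f)

instance monoidalCategory : MonoidalCategory E.Cat := strictTensor.monoidalCategory

instance strictMonoidal : StrictMonoidal E.Cat := strictTensor.strictMonoidal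

/-- The class of a generator modulo the relations of the theory. -/
def gen (E : EqTheory.{u, v, w}) (x : E.E₂) : (⟨⟨E.s₁ x⟩⟩ : E.Cat) ⟶ ⟨⟨E.t₁ x⟩⟩ :=
  ofHom (E.toSignature.gen x)

end Cat

/-- A theory is a presentation of a strict monoidal category `M` when `M` is monoidally equivalent
to the category generated by the theory. -/
def IsPresentation (E : EqTheory.{u, v, w}) (M : Type u₁) [Category.{v₁} M] [MonoidalCategory M]
    [StrictMonoidal M] : Prop :=
  MonoidallyEquivalent M E.Cat

end EqTheory

/-! ### The theory of bicommutative bialgebras -/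

namespace Bialg

/-- The generators for morphisms. -/
inductive Gen : Type
  | mu | eta | delta | eps | gam

/-- The word of length `n` on the only generator for objects. -/
abbrev ob (n : ℕ) : List Unit := List.replicate n ()

/-- The signature: one generator for objects, and
`μ : 2 → 1`, `η : 0 → 1`, `δ : 1 → 2`, `ε : 1 → 0`, `γ : 2 → 2`. -/
abbrev sig : Signature.{0, 0} where
  E₁ := Unit
  E₂ := Gen
  s₁ x := match x with
    | .mu => ob 2 | .eta => ob 0 | .delta => ob 1 | .eps => ob 1 | .gam => ob 2
  t₁ x := match x with
    | .mu => ob 1 | .eta => ob 1 | .delta => ob 2 | .eps => ob 0 | .gam => ob 2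

/-- The free strict monoidal category on the signature of bialgebras. -/
abbrev Syn : Type := sig.FreeCat

/-- The object `n` of the syntactic category. -/
abbrev N (n : ℕ) : Syn := ⟨ob n⟩

/-- The identity of the object `1`. -/
abbrev I : N 1 ⟶ N 1 := 𝟙 (N 1)
abbrev μ : N 2 ⟶ N 1 := sig.gen .mu
abbrev η : N 0 ⟶ N 1 := sig.gen .eta
abbrev δ : N 1 ⟶ N 2 := sig.gen .delta
abbrev ε : N 1 ⟶ N 0 := sig.gen .eps
abbrev γ : N 2 ⟶ N 2 := sig.gen .gam

/-- The morphisms `id₁ ⊗ γ`, `γ ⊗ id₁` and `id₁ ⊗ γ ⊗ id₁`. -/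
abbrev Iγ : N 3 ⟶ N 3 := I ⊗ₘ γ
abbrev γI : N 3 ⟶ N 3 := γ ⊗ₘ I
abbrev IγI : N 4 ⟶ N 4 := Iγ ⊗ₘ I

/-- Names of the twenty-two relations. -/
inductive Rel : Type
  | yangBaxter | symSym
  | mulAssoc | unitMul | mulUnit | mulNatL | mulNatR | unitNatL | unitNatR | mulComm
  | comulCoassoc | counitComul | comulCounit | comulNatL | comulNatR | counitNatL | counitNatR
  | comulComm
  | mulComul | unitComul | mulCounit | unitCounit

/-- The source of the two sides of a relation. -/
abbrev relSrc : Rel → ℕ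
  | .yangBaxter => 3 | .symSym => 2
  | .mulAssoc => 3 | .unitMul => 1 | .mulUnit => 1 | .mulNatL => 3 | .mulNatR => 3
  | .unitNatL => 1 | .unitNatR => 1 | .mulComm => 2
  | .comulCoassoc => 1 | .counitComul => 1 | .comulCounit => 1 | .comulNatL => 2 | .comulNatR => 2
  | .counitNatL => 2 | .counitNatR => 2 | .comulComm => 1
  | .mulComul => 2 | .unitComul => 0 | .mulCounit => 2 | .unitCounit => 0

/-- The target of the two sides of a relation. -/
abbrev relTgt : Rel → ℕ
  | .yangBaxter => 3 | .symSym => 2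
  | .mulAssoc => 1 | .unitMul => 1 | .mulUnit => 1 | .mulNatL => 2 | .mulNatR => 2
  | .unitNatL => 2 | .unitNatR => 2 | .mulComm => 1
  | .comulCoassoc => 3 | .counitComul => 1 | .comulCounit => 1 | .comulNatL => 3 | .comulNatR => 3
  | .counitNatL => 1 | .counitNatR => 1 | .comulComm => 2
  | .mulComul => 2 | .unitComul => 2 | .mulCounit => 0 | .unitCounit => 0

/-- The two sides of each relation. -/
def sides : ∀ r : Rel, (N (relSrc r) ⟶ N (relTgt r)) × (N (relSrc r) ⟶ N (relTgt r))
  -- symmetry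
  | .yangBaxter => (Iγ ≫ γI ≫ Iγ, γI ≫ Iγ ≫ γI)
  | .symSym => (γ ≫ γ, 𝟙 (N 2))
  -- commutative monoid
  | .mulAssoc => ((μ ⊗ₘ I) ≫ μ, (I ⊗ₘ μ) ≫ μ)
  | .unitMul => ((η ⊗ₘ I) ≫ μ, I)
  | .mulUnit => ((I ⊗ₘ η) ≫ μ, I)
  | .mulNatL => ((μ ⊗ₘ I) ≫ γ, Iγ ≫ γI ≫ (I ⊗ₘ μ))
  | .mulNatR => ((I ⊗ₘ μ) ≫ γ, γI ≫ Iγ ≫ (μ ⊗ₘ I))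
  | .unitNatL => ((η ⊗ₘ I) ≫ γ, I ⊗ₘ η)
  | .unitNatR => ((I ⊗ₘ η) ≫ γ, η ⊗ₘ I)
  | .mulComm => (γ ≫ μ, μ)
  -- cocommutative comonoid
  | .comulCoassoc => (δ ≫ (δ ⊗ₘ I), δ ≫ (I ⊗ₘ δ))
  | .counitComul => (δ ≫ (ε ⊗ₘ I), I)
  | .comulCounit => (δ ≫ (I ⊗ₘ ε), I)
  | .comulNatL => (γ ≫ (δ ⊗ₘ I), (I ⊗ₘ δ) ≫ γI ≫ Iγ)
  | .comulNatR => (γ ≫ (I ⊗ₘ δ), (δ ⊗ₘ I) ≫ Iγ ≫ γI)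
  | .counitNatL => (γ ≫ (ε ⊗ₘ I), I ⊗ₘ ε)
  | .counitNatR => (γ ≫ (I ⊗ₘ ε), ε ⊗ₘ I)
  | .comulComm => (δ ≫ γ, δ)
  -- compatibility of the two structures
  | .mulComul => (μ ≫ δ, (δ ⊗ₘ δ) ≫ IγI ≫ (μ ⊗ₘ μ))
  | .unitComul => (η ≫ δ, η ⊗ₘ η)
  | .mulCounit => (μ ≫ ε, ε ⊗ₘ ε)
  | .unitCounit => (η ≫ ε, 𝟙 (N 0))

/-- The equational theory of bicommutative bialgebras. -/
abbrev theory : EqTheory.{0, 0, 0} where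
  toSignature := sig
  E₃ := Rel
  src r := N (relSrc r)
  tgt r := N (relTgt r)
  s₂ r := (sides r).1
  t₂ r := (sides r).2

end Bialg

/-! ### Multirelations -/

/-- The objects of the category of multirelations are the finite ordinals. -/
structure MRel : Type where
  of ::
  card : ℕ

namespace MRel

/-- A morphism `m ⟶ n` is a multirelation `Fin m → Fin n → ℕ`; the composite of `R₁` and `R₂` is
`(a, c) ↦ ∑ b, R₁ a b * R₂ b c`. -/
instance category : Category.{0} MRel where
  Hom m n := Matrix (Fin m.card) (Fin n.card) ℕ
  id m := (1 : Matrix (Fin m.card) (Fin m.card) ℕ)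
  comp {m n p} (R₁ : Matrix (Fin m.card) (Fin n.card) ℕ)
    (R₂ : Matrix (Fin n.card) (Fin p.card) ℕ) := R₁ * R₂
  id_comp R := Matrix.one_mul R
  comp_id R := Matrix.mul_one R
  assoc R₁ R₂ R₃ := Matrix.mul_assoc R₁ R₂ R₃

/-- A matrix with natural number coefficients, as a multirelation. -/
abbrev ofMatrix {m n : ℕ} (R : Matrix (Fin m) (Fin n) ℕ) : of m ⟶ of n := R

/-- The coefficients of a multirelation. -/
abbrev coeff {m n : MRel} (R : m ⟶ n) : Matrix (Fin m.card) (Fin n.card) ℕ := R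

/-- The disjoint union of two multirelations. -/
def sum {m n p q : ℕ} (R : Matrix (Fin m) (Fin n) ℕ) (R' : Matrix (Fin p) (Fin q) ℕ) :
    Matrix (Fin (m + p)) (Fin (n + q)) ℕ :=
  Matrix.reindex finSumFinEquiv finSumFinEquiv (Matrix.fromBlocks R 0 0 R')

theorem coeff_comp_eqToHom {m n p : MRel} (R : m ⟶ n) (h : n = p) (i : Fin m.card)
    (j : Fin p.card) :
    coeff (R ≫ eqToHom h) i j = coeff R i (Fin.cast (congrArg card h.symm) j) := by
  subst h
  exact congrFun (congrFun (Matrix.mul_one R) i) j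

theorem coeff_eqToHom_comp {m n p : MRel} (R : n ⟶ p) (h : m = n) (i : Fin m.card)
    (j : Fin p.card) :
    coeff (eqToHom h ≫ R) i j = coeff R (Fin.cast (congrArg card h) i) j := by
  subst h
  exact congrFun (congrFun (Matrix.one_mul R) i) j

theorem sum_one_one (m n : ℕ) :
    sum (1 : Matrix (Fin m) (Fin m) ℕ) (1 : Matrix (Fin n) (Fin n) ℕ) = 1 := by
  simp [sum]

theorem sum_mul_sum {m n p m' n' p' : ℕ} (R : Matrix (Fin m) (Fin n) ℕ)
    (R' : Matrix (Fin m') (Fin n') ℕ) (Q : Matrix (Fin n) (Fin p) ℕ)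
    (Q' : Matrix (Fin n') (Fin p') ℕ) : sum R R' * sum Q Q' = sum (R * Q) (R' * Q') := by
  simp [sum, Matrix.submatrix_mul_equiv, Matrix.fromBlocks_multiply]

section

variable {m n p q : ℕ} (R : Matrix (Fin m) (Fin n) ℕ) (R' : Matrix (Fin p) (Fin q) ℕ)

theorem sum_inl_inl (i : Fin m) (j : Fin n) :
    sum R R' (Fin.castAdd p i) (Fin.castAdd q j) = R i j := by
  simp [sum]

theorem sum_inl_inr (i : Fin m) (j : Fin q) :
    sum R R' (Fin.castAdd p i) (Fin.natAdd n j) = 0 := by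
  simp [sum]

theorem sum_inr_inl (i : Fin p) (j : Fin n) :
    sum R R' (Fin.natAdd m i) (Fin.castAdd q j) = 0 := by
  simp [sum]

theorem sum_inr_inr (i : Fin p) (j : Fin q) :
    sum R R' (Fin.natAdd m i) (Fin.natAdd n j) = R' i j := by
  simp [sum]

end

theorem sum_assoc_apply {m n m' n' m'' n'' : ℕ} (R : Matrix (Fin m) (Fin n) ℕ)
    (R' : Matrix (Fin m') (Fin n') ℕ) (R'' : Matrix (Fin m'') (Fin n'') ℕ)
    (i : Fin (m + m' + m'')) (j : Fin (n + (n' + n''))) :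
    sum (sum R R') R'' i (Fin.cast (Nat.add_assoc n n' n'').symm j) =
      sum R (sum R' R'') (Fin.cast (Nat.add_assoc m m' m'') i) j := by
  have c₁ (a b c : ℕ) (k : Fin a) : Fin.cast (Nat.add_assoc a b c)
      (Fin.castAdd c (Fin.castAdd b k)) = Fin.castAdd (b + c) k := by ext; simp
  have c₂ (a b c : ℕ) (k : Fin b) : Fin.cast (Nat.add_assoc a b c)
      (Fin.castAdd c (Fin.natAdd a k)) = Fin.natAdd a (Fin.castAdd c k) := by ext; simp
  have c₃ (a b c : ℕ) (k : Fin c) : Fin.cast (Nat.add_assoc a b c)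
      (Fin.natAdd (a + b) k) = Fin.natAdd a (Fin.natAdd b k) := by ext; simp [Nat.add_assoc]
  obtain ⟨j, rfl⟩ : ∃ k, j = Fin.cast (Nat.add_assoc n n' n'') k := ⟨Fin.cast (by omega) j, rfl⟩
  rw [show Fin.cast (Nat.add_assoc n n' n'').symm (Fin.cast (Nat.add_assoc n n' n'') j) = j from rfl]
  refine Fin.addCases (fun i => Fin.addCases (fun i => ?_) (fun i => ?_) i) (fun i => ?_) i <;>
  refine Fin.addCases (fun j => Fin.addCases (fun j => ?_) (fun j => ?_) j) (fun j => ?_) j <;>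
  simp only [c₁, c₂, c₃, sum_inl_inl, sum_inl_inr, sum_inr_inl, sum_inr_inr]

theorem sum_zero_left_apply {m n : ℕ} (R : Matrix (Fin m) (Fin n) ℕ) (i : Fin (0 + m))
    (j : Fin n) :
    sum (1 : Matrix (Fin 0) (Fin 0) ℕ) R i (Fin.cast (Nat.zero_add n).symm j) =
      R (Fin.cast (Nat.zero_add m) i) j := by
  have hi : i = Fin.natAdd 0 (Fin.cast (Nat.zero_add m) i) := by ext; simp
  have hj : Fin.cast (Nat.zero_add n).symm j = Fin.natAdd 0 j := by ext; simp
  conv_lhs => rw [hj, hi]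
  exact sum_inr_inr _ _ _ _

theorem sum_zero_right_apply {m n : ℕ} (R : Matrix (Fin m) (Fin n) ℕ) (i : Fin (m + 0))
    (j : Fin n) :
    sum R (1 : Matrix (Fin 0) (Fin 0) ℕ) i (Fin.cast (Nat.add_zero n).symm j) =
      R (Fin.cast (Nat.add_zero m) i) j :=
  sum_inl_inl R (1 : Matrix (Fin 0) (Fin 0) ℕ) i j

/-- The tensor product, given on objects and morphisms by disjoint union. -/
def strictTensor : StrictTensor MRel where
  unit := of 0
  obj m n := of (m.card + n.card)
  assoc_obj _ _ _ := congrArg of (Nat.add_assoc _ _ _)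
  unit_obj _ := congrArg of (Nat.zero_add _)
  obj_unit _ := congrArg of (Nat.add_zero _)
  hom R R' := sum R R'
  hom_id m n := sum_one_one m.card n.card
  hom_comp R R' Q Q' := sum_mul_sum R R' Q Q'
  assoc_hom R R' R'' := by
    refine Matrix.ext fun i j => ?_
    exact (coeff_comp_eqToHom _ _ i j).trans
      ((sum_assoc_apply R R' R'' i j).trans (coeff_eqToHom_comp _ _ i j).symm)
  unit_hom R := by
    refine Matrix.ext fun i j => ?_
    exact (coeff_comp_eqToHom _ _ i j).trans
      ((sum_zero_left_apply R i j).trans (coeff_eqToHom_comp _ _ i j).symm)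
  hom_unit R := by
    refine Matrix.ext fun i j => ?_
    exact (coeff_comp_eqToHom _ _ i j).trans
      ((sum_zero_right_apply R i j).trans (coeff_eqToHom_comp _ _ i j).symm)

instance monoidalCategory : MonoidalCategory MRel := strictTensor.monoidalCategory

instance strictMonoidal : StrictMonoidal MRel := strictTensor.strictMonoidal

/-- The multirelations that make the object `1` a bicommutative bialgebra. -/
def interpGen : ∀ x : Bialg.Gen,
    of (Bialg.theory.s₁ x).length ⟶ of (Bialg.theory.t₁ x).length
  | .mu => ofMatrix !![1; 1]
  | .eta => ofMatrix (0 : Matrix (Fin 0) (Fin 1) ℕ)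
  | .delta => ofMatrix !![1, 1]
  | .eps => ofMatrix (0 : Matrix (Fin 1) (Fin 0) ℕ)
  | .gam => ofMatrix !![0, 1; 1, 0]

end MRel

/-- A functor from the category generated by the theory of bicommutative bialgebras to multirelations
is the interpretation functor when it is strict monoidal, sends a word to its length (in particular
`1` to `1`) and sends the generators to the multirelations `MRel.interpGen`. -/
structure IsInterpretation (F : Bialg.theory.Cat ⥤ MRel) : Prop where
  strict : IsStrictMonoidal F
  obj : ∀ X, F.obj X = MRel.of X.as.word.length
  map_gen : ∀ x : Bialg.Gen, F.map (EqTheory.Cat.gen Bialg.theory x) =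
    eqToHom (obj _) ≫ MRel.interpGen x ≫ eqToHom (obj _).symm

/-!
An action of the theory of bicommutative bialgebras on a category `K` is a bicommutative bialgebra
`T` in the endofunctors of `K`. On `T ⋙ T` it has the shears `pass k : (x, y) ↦ (y + k x, x)`;
composing shears gives, for a row `r` of natural numbers, a morphism `row r : T X ⟶ X` that adds
`r i` copies of the first strand to the `i`-th strand of `X = Tⁿ X₀`, and the rows of a matrix,
added one after the other to a power of the unit `η`, give a normal form for that matrix.

The generators slide past rows, acting on them by their matrices, and they preserve the powers of
`η`. As every morphism is a composite of morphisms `w ◁ x ▷ Z` with `x` a generator, every morphism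
`f` does the same, so composing `f` with the normal form of the identity matrix, which is the
identity, gives the normal form of the matrix of `f`. The interpretation functor is therefore
faithful, and it is full because a normal form has the matrix it was built from. Being bijective on
objects, it has a strict inverse.
-/

/-- A bicommutative bialgebra in the monoidal category of endofunctors of `K`, with composition as
tensor product: what an action of the theory of bicommutative bialgebras on `K` amounts to. The
symmetry exists only between copies of `T`. The relation `γ ∘ (η ⊗ 1) = 1 ⊗ η` has no field: it
follows from `swap_swap` and `map_one_swap`. -/
structure BialgebraAction (K : Type u) [Category.{v} K] where
  T : K ⥤ K
  mul : T ⋙ T ⟶ T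
  one : 𝟭 K ⟶ T
  comul : T ⟶ T ⋙ T
  counit : T ⟶ 𝟭 K
  swap : T ⋙ T ⟶ T ⋙ T
  swap_swap X : swap.app X ≫ swap.app X = 𝟙 _
  yangBaxter X : T.map (swap.app X) ≫ swap.app (T.obj X) ≫ T.map (swap.app X) =
    swap.app (T.obj X) ≫ T.map (swap.app X) ≫ swap.app (T.obj X)
  mul_assoc X : mul.app (T.obj X) ≫ mul.app X = T.map (mul.app X) ≫ mul.app X
  one_mul X : one.app (T.obj X) ≫ mul.app X = 𝟙 _
  mul_one X : T.map (one.app X) ≫ mul.app X = 𝟙 _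
  mul_swap X : mul.app (T.obj X) ≫ swap.app X =
    T.map (swap.app X) ≫ swap.app (T.obj X) ≫ T.map (mul.app X)
  map_mul_swap X : T.map (mul.app X) ≫ swap.app X =
    swap.app (T.obj X) ≫ T.map (swap.app X) ≫ mul.app (T.obj X)
  map_one_swap X : T.map (one.app X) ≫ swap.app X = one.app (T.obj X)
  swap_mul X : swap.app X ≫ mul.app X = mul.app X
  comul_assoc X : comul.app X ≫ comul.app (T.obj X) = comul.app X ≫ T.map (comul.app X)
  comul_counit X : comul.app X ≫ counit.app (T.obj X) = 𝟙 _
  comul_map_counit X : comul.app X ≫ T.map (counit.app X) = 𝟙 _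
  swap_comul X : swap.app X ≫ comul.app (T.obj X) =
    T.map (comul.app X) ≫ swap.app (T.obj X) ≫ T.map (swap.app X)
  swap_map_comul X : swap.app X ≫ T.map (comul.app X) =
    comul.app (T.obj X) ≫ T.map (swap.app X) ≫ swap.app (T.obj X)
  swap_counit X : swap.app X ≫ counit.app (T.obj X) = T.map (counit.app X)
  swap_map_counit X : swap.app X ≫ T.map (counit.app X) = counit.app (T.obj X)
  comul_swap X : comul.app X ≫ swap.app X = comul.app X
  mul_comul X : mul.app X ≫ comul.app X =
    comul.app (T.obj X) ≫ T.map (T.map (comul.app X)) ≫ T.map (swap.app (T.obj X)) ≫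
      mul.app (T.obj (T.obj X)) ≫ T.map (mul.app X)
  one_comul X : one.app X ≫ comul.app X = one.app X ≫ T.map (one.app X)
  mul_counit X : mul.app X ≫ counit.app X = counit.app (T.obj X) ≫ counit.app X
  one_counit X : one.app X ≫ counit.app X = 𝟙 _

namespace BialgebraAction

variable {K : Type u} [Category.{v} K] (B : BialgebraAction K)

section Naturality

variable {X Y : K} (f : X ⟶ Y)

theorem mul_naturality : B.T.map (B.T.map f) ≫ B.mul.app Y = B.mul.app X ≫ B.T.map f :=
  B.mul.naturality f

theorem comul_naturality :
    B.T.map f ≫ B.comul.app Y = B.comul.app X ≫ B.T.map (B.T.map f) :=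
  B.comul.naturality f

theorem swap_naturality :
    B.T.map (B.T.map f) ≫ B.swap.app Y = B.swap.app X ≫ B.T.map (B.T.map f) :=
  B.swap.naturality f

theorem counit_naturality : B.T.map f ≫ B.counit.app Y = B.counit.app X ≫ f :=
  B.counit.naturality f

theorem one_naturality : f ≫ B.one.app Y = B.one.app X ≫ B.T.map f :=
  B.one.naturality f

end Naturality

/-- The shear `(x, y) ↦ (y + k x, x)` on two copies of the bialgebra: it moves a strand past
another one and adds `k` copies of it to that one. These are the building blocks of the normal
forms below. -/
def pass : ℕ → ∀ X : K, B.T.obj (B.T.obj X) ⟶ B.T.obj (B.T.obj X)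
  | 0, X => B.swap.app X
  | k + 1, X => B.comul.app (B.T.obj X) ≫ B.T.map (pass k X) ≫ B.mul.app (B.T.obj X)

theorem pass_naturality (k : ℕ) {X Y : K} (f : X ⟶ Y) :
    B.T.map (B.T.map f) ≫ B.pass k Y = B.pass k X ≫ B.T.map (B.T.map f) := by
  induction k with
  | zero => exact B.swap_naturality f
  | succ k ih =>
    have map_ih := congrArg B.T.map ih
    simp only [Functor.map_comp] at map_ih
    simp only [pass, Category.assoc]
    rw [reassoc_of% B.comul_naturality, reassoc_of% map_ih, B.mul_naturality]

theorem pass_counit (k : ℕ) (X : K) :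
    B.pass k X ≫ B.counit.app (B.T.obj X) = B.T.map (B.counit.app X) := by
  induction k with
  | zero => exact B.swap_counit X
  | succ k ih =>
    have map_ih := congrArg B.T.map ih
    rw [Functor.map_comp] at map_ih
    simp only [pass, Category.assoc]
    rw [B.mul_counit, ← B.counit_naturality (Y := B.T.obj X),
      reassoc_of% map_ih, B.counit_naturality (Y := B.T.obj X), reassoc_of% B.comul_counit]

theorem pass_map_comul (k : ℕ) (X : K) :
    B.pass k X ≫ B.T.map (B.comul.app X) =
      B.comul.app (B.T.obj X) ≫ B.T.map (B.pass k X) ≫ B.swap.app (B.T.obj X) := by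
  induction k with
  | zero => exact B.swap_map_comul X
  | succ k ih =>
    have map_ih := congrArg B.T.map ih
    simp only [Functor.map_comp] at map_ih
    simp only [pass, Functor.map_comp, Category.assoc]
    rw [← B.mul_naturality, reassoc_of% map_ih, B.map_mul_swap, reassoc_of% B.swap_naturality,
      ← reassoc_of% B.comul_assoc, ← reassoc_of% B.comul_assoc, reassoc_of% B.comul_swap]
    rfl

theorem pass_comul (k : ℕ) (X : K) :
    B.pass k X ≫ B.comul.app (B.T.obj X) =
      B.T.map (B.comul.app X) ≫ B.pass k (B.T.obj X) ≫ B.T.map (B.pass k X) := by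
  induction k with
  | zero => exact B.swap_comul X
  | succ k ih =>
    have map_map_ih := congrArg (fun f => B.T.map (B.T.map f)) ih
    have map_pass_map_comul := congrArg B.T.map (B.pass_map_comul k (B.T.obj X))
    have map_swap_naturality := congrArg B.T.map (B.swap_naturality (B.pass k X))
    simp only [Functor.map_comp] at map_map_ih map_pass_map_comul map_swap_naturality
    simp only [pass, Functor.map_comp, Category.assoc]
    rw [← reassoc_of% B.mul_naturality, reassoc_of% map_pass_map_comul, B.mul_comul,
      reassoc_of% B.comul_naturality, reassoc_of% map_map_ih, reassoc_of% map_swap_naturality,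
      ← reassoc_of% B.mul_naturality, ← reassoc_of% B.comul_assoc,
      reassoc_of% B.comul_naturality (B.comul.app X),
      reassoc_of% B.comul_naturality (B.T.map (B.comul.app X))]

theorem swap_pass_mul (l : ℕ) (X : K) :
    B.swap.app (B.T.obj X) ≫ B.T.map (B.pass l X) ≫ B.mul.app (B.T.obj X) =
      B.T.map (B.mul.app X) ≫ B.pass l X := by
  induction l with
  | zero => exact (B.map_mul_swap X).symm
  | succ l ih =>
    have map_ih := congrArg B.T.map ih
    simp only [Functor.map_comp] at map_ih
    simp only [pass, Functor.map_comp, Category.assoc]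
    rw [← B.mul_assoc, reassoc_of% B.swap_map_comul, ← reassoc_of% B.swap_naturality,
      reassoc_of% B.swap_mul, B.mul_assoc, reassoc_of% map_ih, ← reassoc_of% B.comul_naturality]

theorem pass_pass_mul (k l : ℕ) (X : K) :
    B.pass k (B.T.obj X) ≫ B.T.map (B.pass l X) ≫ B.mul.app (B.T.obj X) =
      B.T.map (B.mul.app X) ≫ B.pass (k + l) X := by
  induction k with
  | zero => rw [Nat.zero_add]; exact B.swap_pass_mul l X
  | succ k ih =>
    have map_ih := congrArg B.T.map ih
    simp only [Functor.map_comp] at map_ih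
    simp only [Nat.succ_add, pass, Category.assoc]
    rw [← reassoc_of% B.mul_naturality, B.mul_assoc, reassoc_of% map_ih,
      ← reassoc_of% B.comul_naturality]

theorem swap_pass_swap (l : ℕ) (X : K) :
    B.swap.app (B.T.obj X) ≫ B.T.map (B.pass l X) ≫ B.swap.app (B.T.obj X) =
      B.T.map (B.swap.app X) ≫ B.pass l (B.T.obj X) ≫ B.T.map (B.swap.app X) := by
  induction l with
  | zero => exact (B.yangBaxter X).symm
  | succ l ih =>
    have map_ih := congrArg B.T.map ih
    simp only [Functor.map_comp] at map_ih
    simp only [pass, Functor.map_comp, Category.assoc]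
    rw [B.map_mul_swap, reassoc_of% B.swap_map_comul, ← reassoc_of% B.swap_naturality,
      reassoc_of% B.swap_swap, reassoc_of% map_ih, ← reassoc_of% B.comul_naturality,
      B.mul_naturality]

theorem pass_pass_swap (k l : ℕ) (X : K) :
    B.pass k (B.T.obj X) ≫ B.T.map (B.pass l X) ≫ B.swap.app (B.T.obj X) =
      B.T.map (B.swap.app X) ≫ B.pass l (B.T.obj X) ≫ B.T.map (B.pass k X) := by
  induction k with
  | zero => exact B.swap_pass_swap l X
  | succ k ih =>
    have map_ih := congrArg B.T.map ih
    simp only [Functor.map_comp] at map_ih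
    simp only [pass, Functor.map_comp, Category.assoc]
    rw [← reassoc_of% B.mul_naturality, B.mul_swap, reassoc_of% map_ih,
      ← reassoc_of% B.comul_naturality, reassoc_of% B.pass_map_comul,
      reassoc_of% B.swap_naturality]

theorem map_one_pass_one (X : K) :
    B.T.map (B.one.app X) ≫ B.pass 1 X = B.comul.app X := by
  have map_map_one_swap := congrArg B.T.map (B.map_one_swap X)
  rw [Functor.map_comp] at map_map_one_swap
  simp only [pass]
  rw [reassoc_of% B.comul_naturality, reassoc_of% map_map_one_swap, B.mul_one]
  exact Category.comp_id _

open Matrix (vecCons vecTail)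

/-- A witness that the object `X` of `K` is `Tⁿ X₀`. Recursion on such witnesses, rather than on
`n`, makes morphisms to and from `X` definable without transport along equalities of objects. -/
inductive Power (X₀ : K) : ℕ → K → Type u
  | zero : Power X₀ 0 X₀
  | succ {n : ℕ} {X : K} : Power X₀ n X → Power X₀ (n + 1) (B.T.obj X)

namespace Power

variable {B} {X₀ X Y Z : K} {l m n : ℕ}

/-- The morphism `T X ⟶ X` that adds `r i` copies of the first strand to the `i`-th strand of
`X`, for all `i`. -/
def row : ∀ {n : ℕ} {X : K}, B.Power X₀ n X → (Fin n → ℕ) → (B.T.obj X ⟶ X)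
  | _, _, zero, _ => B.counit.app X₀
  | _, _, succ p, r => B.pass (r 0) _ ≫ B.T.map (p.row (vecTail r))

/-- The power of the unit `η`. -/
def unit : ∀ {n : ℕ} {X : K}, B.Power X₀ n X → (X₀ ⟶ X)
  | _, _, zero => 𝟙 X₀
  | _, _, succ p => p.unit ≫ B.one.app _

/-- The normal form of the morphisms with a given matrix: starting from units, the rows of the
matrix are added one after the other. -/
def mat (q : B.Power X₀ n Y) :
    ∀ {m : ℕ} {X : K}, B.Power X₀ m X → (Fin m → Fin n → ℕ) → (X ⟶ Y)
  | _, _, zero, _ => q.unit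
  | _, _, succ p, R => B.T.map (mat q p (vecTail R)) ≫ q.row (R 0)

/-- The morphism `f` slides past rows by acting on them through `φ`, and preserves units. -/
structure Intertwines (p : B.Power X₀ m X) (q : B.Power X₀ n Y) (f : X ⟶ Y)
    (φ : (Fin m → ℕ) → (Fin n → ℕ)) : Prop where
  row_comp : ∀ r, p.row r ≫ f = B.T.map f ≫ q.row (φ r)
  unit_comp : p.unit ≫ f = q.unit

theorem row_zero (p : B.Power X₀ n X) : p.row 0 = B.counit.app X := by
  induction p with
  | zero => rfl
  | succ p ih => exact (congrArg (B.swap.app _ ≫ B.T.map ·) ih).trans (B.swap_map_counit _)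

namespace Intertwines

variable {p : B.Power X₀ m X} {q : B.Power X₀ n Y} {s : B.Power X₀ l Z} {f : X ⟶ Y} {g : Y ⟶ Z}
  {φ : (Fin m → ℕ) → (Fin n → ℕ)} {ψ : (Fin n → ℕ) → (Fin l → ℕ)}

theorem mat_comp (h : Intertwines p q f φ) (s : B.Power X₀ l Z) (R : Fin l → Fin m → ℕ) :
    p.mat s R ≫ f = q.mat s fun i => φ (R i) := by
  induction s with
  | zero => exact h.unit_comp
  | succ s ih =>
    calc (B.T.map (p.mat s (vecTail R)) ≫ p.row (R 0)) ≫ f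
      _ = B.T.map (p.mat s (vecTail R) ≫ f) ≫ q.row (φ (R 0)) := by
        rw [Category.assoc, h.row_comp, Functor.map_comp_assoc]
      _ = B.T.map (q.mat s fun i => φ (vecTail R i)) ≫ q.row (φ (R 0)) := by rw [ih]

theorem id (p : B.Power X₀ m X) : Intertwines p p (𝟙 X) _root_.id where
  row_comp r := by rw [Category.comp_id, B.T.map_id, Category.id_comp]; rfl
  unit_comp := Category.comp_id _

theorem comp (hf : Intertwines p q f φ) (hg : Intertwines q s g ψ) :
    Intertwines p s (f ≫ g) (ψ ∘ φ) where
  row_comp r := by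
    rw [reassoc_of% hf.row_comp, hg.row_comp, Functor.map_comp_assoc, Function.comp_apply]
  unit_comp := by rw [← Category.assoc, hf.unit_comp, hg.unit_comp]

theorem map (h : Intertwines p q f φ) :
    Intertwines p.succ q.succ (B.T.map f) fun r => vecCons (r 0) (φ (vecTail r)) where
  row_comp r := by
    change (_ ≫ _) ≫ _ = _ ≫ B.pass (r 0) Y ≫ B.T.map (q.row (φ (vecTail r)))
    rw [Category.assoc, ← Functor.map_comp, h.row_comp, Functor.map_comp,
      reassoc_of% B.pass_naturality]
  unit_comp := by
    change (p.unit ≫ _) ≫ _ = q.unit ≫ _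
    rw [← h.unit_comp, Category.assoc, Category.assoc, ← B.one_naturality]

variable (p)

theorem mul :
    Intertwines p.succ.succ p.succ (B.mul.app X)
      fun r => vecCons (r 0 + r 1) (vecTail (vecTail r)) where
  row_comp r := by
    change (B.pass (r 0) _ ≫ B.T.map (B.pass (r 1) X ≫ B.T.map (p.row _))) ≫ _ =
      _ ≫ B.pass (r 0 + r 1) X ≫ B.T.map (p.row (vecTail (vecTail r)))
    rw [Category.assoc, Functor.map_comp, Category.assoc, B.mul_naturality,
      reassoc_of% B.pass_pass_mul]
  unit_comp := by
    change (_ ≫ B.one.app (B.T.obj X)) ≫ _ = _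
    rw [Category.assoc, B.one_mul]
    exact Category.comp_id _

theorem one : Intertwines p p.succ (B.one.app X) (vecCons 0) where
  row_comp r := by
    change _ = _ ≫ B.swap.app X ≫ B.T.map (p.row r)
    exact (B.one_naturality _).trans (by rw [reassoc_of% B.map_one_swap])
  unit_comp := rfl

theorem comul :
    Intertwines p.succ p.succ.succ (B.comul.app X) fun r => vecCons (r 0) r where
  row_comp r := by
    change (B.pass (r 0) X ≫ B.T.map (p.row _)) ≫ _ =
      _ ≫ B.pass (r 0) _ ≫ B.T.map (B.pass (r 0) X ≫ B.T.map (p.row (vecTail r)))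
    rw [Category.assoc, B.comul_naturality, reassoc_of% B.pass_comul, Functor.map_comp]
  unit_comp := by
    change (_ ≫ B.one.app X) ≫ _ = (_ ≫ B.one.app X) ≫ B.one.app (B.T.obj X)
    rw [Category.assoc, Category.assoc, B.one_comul, ← B.one_naturality]

theorem counit : Intertwines p.succ p (B.counit.app X) vecTail where
  row_comp r := by
    change (B.pass (r 0) X ≫ B.T.map (p.row (vecTail r))) ≫ _ = _
    rw [Category.assoc, B.counit_naturality, reassoc_of% B.pass_counit]
  unit_comp := by
    change (_ ≫ B.one.app X) ≫ _ = _
    rw [Category.assoc, B.one_counit]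
    exact Category.comp_id _

theorem swap :
    Intertwines p.succ.succ p.succ.succ (B.swap.app X)
      fun r => vecCons (r 1) (vecCons (r 0) (vecTail (vecTail r))) where
  row_comp r := by
    change (B.pass (r 0) _ ≫ B.T.map (B.pass (r 1) X ≫ B.T.map (p.row _))) ≫ _ =
      _ ≫ B.pass (r 1) _ ≫ B.T.map (B.pass (r 0) X ≫ B.T.map (p.row (vecTail (vecTail r))))
    rw [Category.assoc, Functor.map_comp, Category.assoc, B.swap_naturality,
      reassoc_of% B.pass_pass_swap, Functor.map_comp]
  unit_comp := by
    change ((_ ≫ B.one.app X) ≫ B.one.app (B.T.obj X)) ≫ _ =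
      (_ ≫ B.one.app X) ≫ B.one.app (B.T.obj X)
    have one_one_eq : B.one.app X ≫ B.one.app (B.T.obj X) = B.one.app X ≫ B.T.map (B.one.app X) :=
      B.one_naturality _
    simp only [Category.assoc]
    nth_rw 1 [reassoc_of% one_one_eq]
    rw [B.map_one_swap]

end Intertwines

theorem mat_single (p : B.Power X₀ n X) : p.mat p (fun i => Pi.single i 1) = 𝟙 X := by
  induction p with
  | zero => rfl
  | @succ n X p ih =>
    have tail_eq : vecTail (fun i : Fin (n + 1) => (Pi.single i 1 : Fin (n + 1) → ℕ)) =
        fun i => vecCons 0 (Pi.single i 1) := by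
      funext i j; cases j using Fin.cases <;> simp [vecTail, Pi.single_apply]
    have head_tail_eq : vecTail (Pi.single 0 1 : Fin (n + 1) → ℕ) = 0 := by
      funext j; simp [vecTail]
    calc B.T.map (p.succ.mat p (vecTail fun i => Pi.single i 1)) ≫
          B.pass 1 X ≫ B.T.map (p.row (vecTail (Pi.single 0 1)))
      _ = B.T.map (B.one.app X) ≫ B.pass 1 X ≫ B.T.map (B.counit.app X) := by
        rw [tail_eq, ← (Intertwines.one p).mat_comp, ih, head_tail_eq, row_zero]
        congr 2
        exact Category.id_comp _
      _ = B.comul.app X ≫ B.T.map (B.counit.app X) := by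
        rw [← Category.assoc, B.map_one_pass_one]
      _ = 𝟙 _ := B.comul_map_counit X

theorem Intertwines.eq_mat {p : B.Power X₀ m X} {q : B.Power X₀ n Y} {f : X ⟶ Y}
    {φ : (Fin m → ℕ) → (Fin n → ℕ)} (h : Intertwines p q f φ) :
    f = q.mat p fun i => φ (Pi.single i 1) := by
  rw [← h.mat_comp, mat_single, Category.id_comp]

end Power

end BialgebraAction

theorem morphismProperty_of_heq {C : Type u} [Category.{v} C] {P : MorphismProperty C}
    {X Y X' Y' : C} {f : X ⟶ Y} {f' : X' ⟶ Y'} (hX : X' = X) (hY : Y' = Y) (h : f' ≍ f)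
    (hf : P f) : P f' := by
  subst hX hY h; exact hf

theorem tensorHom_heq {D : Type u₁} [Category.{v₁} D] [MonoidalCategory D]
    {X₁ Y₁ X₂ Y₂ X₁' Y₁' X₂' Y₂' : D} {f : X₁ ⟶ Y₁} {g : X₂ ⟶ Y₂} {f' : X₁' ⟶ Y₁'}
    {g' : X₂' ⟶ Y₂'} (h₁ : X₁ = X₁') (h₂ : Y₁ = Y₁') (h₃ : X₂ = X₂') (h₄ : Y₂ = Y₂')
    (hf : f ≍ f') (hg : g ≍ g') : f ⊗ₘ g ≍ f' ⊗ₘ g' := by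
  subst h₁ h₂ h₃ h₄ hf hg; rfl

namespace StrictMonoidal

variable {D : Type u₁} [Category.{v₁} D] [MonoidalCategory D] [StrictMonoidal D]

theorem tensorHom_assoc_heq {X₁ Y₁ X₂ Y₂ X₃ Y₃ : D} (f : X₁ ⟶ Y₁) (g : X₂ ⟶ Y₂) (h : X₃ ⟶ Y₃) :
    (f ⊗ₘ g) ⊗ₘ h ≍ f ⊗ₘ (g ⊗ₘ h) :=
  (conj_eqToHom_iff_heq' _ _ (assoc_obj _ _ _) (assoc_obj _ _ _).symm).1 <| by
    simp only [associator_conjugation, associator_eq, eqToIso.hom, eqToIso.inv]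

theorem tensor_whiskerLeft_heq (X Y : D) {Z Z' : D} (f : Z ⟶ Z') :
    (X ⊗ Y) ◁ f ≍ X ◁ Y ◁ f :=
  (conj_eqToHom_iff_heq' _ _ (assoc_obj _ _ _) (assoc_obj _ _ _).symm).1 <| by
    simp only [tensor_whiskerLeft, associator_eq, eqToIso.hom, eqToIso.inv]

theorem whisker_assoc_heq (X : D) {Y Y' : D} (f : Y ⟶ Y') (Z : D) :
    (X ◁ f) ▷ Z ≍ X ◁ f ▷ Z :=
  (conj_eqToHom_iff_heq' _ _ (assoc_obj _ _ _) (assoc_obj _ _ _).symm).1 <| by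
    simp only [whisker_assoc, associator_eq, eqToIso.hom, eqToIso.inv]

theorem whiskerRight_whiskerRight_heq {X X' : D} (f : X ⟶ X') (Y Z : D) :
    f ▷ Y ▷ Z ≍ f ▷ (Y ⊗ Z) :=
  (conj_eqToHom_iff_heq' _ _ (assoc_obj _ _ _) (assoc_obj _ _ _).symm).1 <| by
    simp [associator_eq]

theorem unit_whiskerLeft_heq {X Y : D} (f : X ⟶ Y) : 𝟙_ D ◁ f ≍ f :=
  (conj_eqToHom_iff_heq' _ _ (unit_obj _) (unit_obj _).symm).1 <| by
    simp only [id_whiskerLeft, leftUnitor_eq, eqToIso.hom, eqToIso.inv]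

theorem whiskerRight_unit_heq {X Y : D} (f : X ⟶ Y) : f ▷ 𝟙_ D ≍ f :=
  (conj_eqToHom_iff_heq' _ _ (obj_unit _) (obj_unit _).symm).1 <| by
    simp only [whiskerRight_id, rightUnitor_eq, eqToIso.hom, eqToIso.inv]

end StrictMonoidal

/-- An interpretation of a signature in a monoidal category: an assignment of objects to words and
of morphisms to generators. The objects are given on all words, not just on letters, so that they
can be chosen up to definitional equality. -/
structure Signature.Interp (S : Signature.{u, v}) (D : Type u₁) [Category.{v₁} D]
    [MonoidalCategory D] where
  obj : List S.E₁ → D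
  obj_nil : obj [] = 𝟙_ D
  obj_append : ∀ a b, obj (a ++ b) = obj a ⊗ obj b
  gen : ∀ x, obj (S.s₁ x) ⟶ obj (S.t₁ x)

namespace Signature.Interp

variable {S : Signature.{u, v}} {D : Type u₁} [Category.{v₁} D] [MonoidalCategory D]
  (φ : S.Interp D)

/-- The value of a term under an interpretation. -/
def eval : ∀ {a b : List S.E₁}, S.Term a b → (φ.obj a ⟶ φ.obj b)
  | _, _, .gen x => φ.gen x
  | _, _, .id _ => 𝟙 _
  | _, _, .comp f g => eval f ≫ eval g
  | _, _, .tensor f g =>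
    eqToHom (φ.obj_append _ _) ≫ (eval f ⊗ₘ eval g) ≫ eqToHom (φ.obj_append _ _).symm

theorem eval_ofEq {a b : List S.E₁} (h : a = b) :
    φ.eval (.ofEq h) = eqToHom (congrArg φ.obj h) := by
  subst h; rfl

theorem eval_comp_ofEq_eq_iff {a b c d : List S.E₁} (f : S.Term a b) (g : S.Term c d) (h : b = d)
    (h' : a = c) :
    φ.eval (.comp f (.ofEq h)) = φ.eval (.comp (.ofEq h') g) ↔ φ.eval f ≍ φ.eval g := by
  subst h h'; simp [eval, eval_ofEq]

theorem eval_tensor_heq {a b c d : List S.E₁} (f : S.Term a b) (g : S.Term c d) :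
    φ.eval (.tensor f g) ≍ φ.eval f ⊗ₘ φ.eval g :=
  (conj_eqToHom_iff_heq' _ _ _ _).1 rfl

theorem eval_id_nil_heq : φ.eval (.id []) ≍ 𝟙 (𝟙_ D) := by
  simp only [eval]; rw [φ.obj_nil]

variable [StrictMonoidal D]

theorem eval_tensor_assoc_heq {a b a' b' a'' b'' : List S.E₁} (f : S.Term a b) (f' : S.Term a' b')
    (f'' : S.Term a'' b'') :
    φ.eval (.tensor (.tensor f f') f'') ≍ φ.eval (.tensor f (.tensor f' f'')) := by
  have left : φ.eval (.tensor (.tensor f f') f'') ≍ (φ.eval f ⊗ₘ φ.eval f') ⊗ₘ φ.eval f'' :=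
    (φ.eval_tensor_heq _ _).trans <|
      tensorHom_heq (φ.obj_append _ _) (φ.obj_append _ _) rfl rfl (φ.eval_tensor_heq _ _) .rfl
  have right : φ.eval (.tensor f (.tensor f' f'')) ≍ φ.eval f ⊗ₘ (φ.eval f' ⊗ₘ φ.eval f'') :=
    (φ.eval_tensor_heq _ _).trans <|
      tensorHom_heq rfl rfl (φ.obj_append _ _) (φ.obj_append _ _) .rfl (φ.eval_tensor_heq _ _)
  exact left.trans ((StrictMonoidal.tensorHom_assoc_heq _ _ _).trans right.symm)

theorem eval_unit_tensor_heq {a b : List S.E₁} (f : S.Term a b) :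
    φ.eval (.tensor (.id []) f) ≍ φ.eval f := by
  have h : φ.eval (.tensor (.id []) f) ≍ 𝟙 (𝟙_ D) ⊗ₘ φ.eval f :=
    (φ.eval_tensor_heq _ _).trans <|
      tensorHom_heq φ.obj_nil φ.obj_nil rfl rfl φ.eval_id_nil_heq .rfl
  rw [id_tensorHom] at h
  exact h.trans (StrictMonoidal.unit_whiskerLeft_heq _)

theorem eval_tensor_unit_heq {a b : List S.E₁} (f : S.Term a b) :
    φ.eval (.tensor f (.id [])) ≍ φ.eval f := by
  have h : φ.eval (.tensor f (.id [])) ≍ φ.eval f ⊗ₘ 𝟙 (𝟙_ D) :=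
    (φ.eval_tensor_heq _ _).trans <|
      tensorHom_heq rfl rfl φ.obj_nil φ.obj_nil .rfl φ.eval_id_nil_heq
  rw [tensorHom_id] at h
  exact h.trans (StrictMonoidal.whiskerRight_unit_heq _)

theorem eval_eq_of_termEq {a b : List S.E₁} {f g : S.Term a b} (h : S.TermEq f g) :
    φ.eval f = φ.eval g := by
  induction h with
  | refl f => rfl
  | symm _ ih => exact ih.symm
  | trans _ _ ih₁ ih₂ => exact ih₁.trans ih₂
  | comp_congr _ _ ih₁ ih₂ => simp only [eval, ih₁, ih₂]
  | tensor_congr _ _ ih₁ ih₂ => simp only [eval, ih₁, ih₂]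
  | id_comp f => simp [eval]
  | comp_id f => simp [eval]
  | assoc f g h => simp [eval]
  | tensor_id a b => simp [eval]
  | interchange f f' g g' => simp [eval]
  | tensor_assoc f f' f'' =>
    exact (φ.eval_comp_ofEq_eq_iff _ _ _ _).2 (φ.eval_tensor_assoc_heq f f' f'')
  | unit_tensor f => exact (φ.eval_comp_ofEq_eq_iff _ _ _ _).2 (φ.eval_unit_tensor_heq f)
  | tensor_unit f => exact (φ.eval_comp_ofEq_eq_iff _ _ _ _).2 (φ.eval_tensor_unit_heq f)

/-- The functor from the free strict monoidal category induced by an interpretation. -/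
def functor : S.FreeCat ⥤ D where
  obj a := φ.obj a.word
  map f := Quotient.lift φ.eval (fun _ _ h => φ.eval_eq_of_termEq h) f
  map_comp := by rintro _ _ _ ⟨f⟩ ⟨g⟩; rfl

theorem functor_isStrictMonoidal : IsStrictMonoidal φ.functor where
  unit_obj := φ.obj_nil
  tensor_obj _ _ := φ.obj_append _ _
  tensor_map := by rintro _ _ _ _ ⟨f⟩ ⟨g⟩; rfl

end Signature.Interp

namespace EqTheory

variable {E : EqTheory.{u, v, w}}

section Lift

variable {D : Type u₁} [Category.{v₁} D] [MonoidalCategory D] {F : E.toSignature.FreeCat ⥤ D}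
  (hF : IsStrictMonoidal F) (h : ∀ e, F.map (E.s₂ e) = F.map (E.t₂ e))

include hF h in
theorem map_eq_of_congruence {a b : E.toSignature.FreeCat} {f g : a ⟶ b}
    (c : E.Congruence f g) : F.map f = F.map g := by
  induction c with
  | rel e => exact h e
  | refl f => rfl
  | symm _ ih => exact ih.symm
  | trans _ _ ih₁ ih₂ => exact ih₁.trans ih₂
  | comp _ _ ih₁ ih₂ => simp only [F.map_comp, ih₁, ih₂]
  | tensor _ _ ih₁ ih₂ => simp only [hF.tensor_map, ih₁, ih₂]

/-- The functor induced on the category generated by a theory by a strict monoidal functor that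
validates its relations. -/
def lift : E.Cat ⥤ D where
  obj a := F.obj a.as
  map f := Quotient.lift F.map (fun _ _ c => map_eq_of_congruence hF h c) f
  map_id a := F.map_id a.as
  map_comp := by rintro _ _ _ ⟨f⟩ ⟨g⟩; exact F.map_comp f g

theorem lift_isStrictMonoidal : IsStrictMonoidal (lift hF h) where
  unit_obj := hF.unit_obj
  tensor_obj _ _ := hF.tensor_obj _ _
  tensor_map := by rintro _ _ _ _ ⟨f⟩ ⟨g⟩; exact hF.tensor_map f g

end Lift

namespace Cat

variable {P : MorphismProperty E.Cat}

variable (whiskerLeft : ∀ (x : E.E₁) {X Y : E.Cat} (f : X ⟶ Y), P f → P ((⟨⟨[x]⟩⟩ : E.Cat) ◁ f))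

include whiskerLeft in
theorem whiskerLeft_mem (w : List E.E₁) {X Y : E.Cat} {f : X ⟶ Y} (hf : P f) :
    P ((⟨⟨w⟩⟩ : E.Cat) ◁ f) := by
  induction w with
  | nil =>
    exact morphismProperty_of_heq (StrictMonoidal.unit_obj X) (StrictMonoidal.unit_obj Y)
      (StrictMonoidal.unit_whiskerLeft_heq f) hf
  | cons x w ih =>
    exact morphismProperty_of_heq rfl rfl
      (StrictMonoidal.tensor_whiskerLeft_heq (⟨⟨[x]⟩⟩ : E.Cat) ⟨⟨w⟩⟩ f) (whiskerLeft x _ ih)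

variable [P.IsMultiplicative] (gen : ∀ (x : E.E₂) (Z : E.Cat), P (Cat.gen E x ▷ Z))

include gen whiskerLeft

theorem ofTerm_whiskerRight_mem {a b : List E.E₁} (f : E.toSignature.Term a b) (Z : E.Cat) :
    P ((ofHom (Signature.FreeCat.ofTerm f) : (⟨⟨a⟩⟩ : E.Cat) ⟶ ⟨⟨b⟩⟩) ▷ Z) := by
  induction f generalizing Z with
  | gen x => exact gen x Z
  | id a => exact (id_whiskerRight (⟨⟨a⟩⟩ : E.Cat) Z).symm ▸ P.id_mem _
  | comp f g ihf ihg =>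
    exact (comp_whiskerRight (ofHom (Signature.FreeCat.ofTerm f))
      (ofHom (Signature.FreeCat.ofTerm g)) Z).symm ▸ P.comp_mem _ _ (ihf Z) (ihg Z)
  | @tensor a b c d f g ihf ihg =>
    let f' : (⟨⟨a⟩⟩ : E.Cat) ⟶ ⟨⟨b⟩⟩ := ofHom (Signature.FreeCat.ofTerm f)
    let g' : (⟨⟨c⟩⟩ : E.Cat) ⟶ ⟨⟨d⟩⟩ := ofHom (Signature.FreeCat.ofTerm g)
    change P ((f' ⊗ₘ g') ▷ Z)
    rw [MonoidalCategory.tensorHom_def, comp_whiskerRight]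
    exact P.comp_mem _ _
      (morphismProperty_of_heq (StrictMonoidal.assoc_obj _ _ _) (StrictMonoidal.assoc_obj _ _ _)
        (StrictMonoidal.whiskerRight_whiskerRight_heq f' ⟨⟨c⟩⟩ Z) (ihf _))
      (morphismProperty_of_heq (StrictMonoidal.assoc_obj _ _ _) (StrictMonoidal.assoc_obj _ _ _)
        (StrictMonoidal.whisker_assoc_heq ⟨⟨b⟩⟩ g' Z) (whiskerLeft_mem whiskerLeft b (ihg Z)))

theorem hom_induction {X Y : E.Cat} (f : X ⟶ Y) : P f := by
  obtain ⟨f, rfl⟩ := Quotient.exists_rep f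
  obtain ⟨f, rfl⟩ := Quotient.exists_rep f
  exact morphismProperty_of_heq (StrictMonoidal.obj_unit X).symm (StrictMonoidal.obj_unit Y).symm
    (StrictMonoidal.whiskerRight_unit_heq (ofHom (Signature.FreeCat.ofTerm f))).symm
    (ofTerm_whiskerRight_mem whiskerLeft gen f (𝟙_ E.Cat))

end Cat

end EqTheory

namespace Bialg

/-- A syntactic morphism tensored on the right with an object, modulo the relations. -/
abbrev whisker {a b : Syn} (f : a ⟶ b) (X : theory.Cat) :
    (⟨a⟩ : theory.Cat) ⊗ X ⟶ (⟨b⟩ : theory.Cat) ⊗ X :=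
  EqTheory.Cat.ofHom (E := theory) f ▷ X

/-- Tensoring on the left with the object `1`. -/
abbrev cons : theory.Cat ⥤ theory.Cat := tensorLeft ⟨N 1⟩

theorem zero_whiskerLeft {X Y : theory.Cat} (f : X ⟶ Y) : (⟨N 0⟩ : theory.Cat) ◁ f = f :=
  (StrictMonoidal.unit_whiskerLeft_heq f).eq

theorem two_whiskerLeft {X Y : theory.Cat} (f : X ⟶ Y) :
    (⟨N 2⟩ : theory.Cat) ◁ f = cons.map (cons.map f) :=
  (StrictMonoidal.tensor_whiskerLeft_heq (⟨N 1⟩ : theory.Cat) ⟨N 1⟩ f).eq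

section Whisker

variable {a b : Syn}

theorem whisker_naturality (f : a ⟶ b) {X Y : theory.Cat} (g : X ⟶ Y) :
    (⟨a⟩ : theory.Cat) ◁ g ≫ whisker f Y = whisker f X ≫ (⟨b⟩ : theory.Cat) ◁ g :=
  whisker_exchange (EqTheory.Cat.ofHom (E := theory) f) g

theorem whisker_id (a : Syn) (X : theory.Cat) : whisker (𝟙 a) X = 𝟙 _ :=
  id_whiskerRight (⟨a⟩ : theory.Cat) X

theorem whisker_comp {c : Syn} (f : a ⟶ b) (g : b ⟶ c) (X : theory.Cat) :
    whisker (f ≫ g) X = whisker f X ≫ whisker g X :=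
  comp_whiskerRight (EqTheory.Cat.ofHom (E := theory) f) (EqTheory.Cat.ofHom g) X

theorem whisker_comp_eq {c : Syn} {f : a ⟶ b} {g : b ⟶ c} {X : theory.Cat}
    {p : (⟨a⟩ : theory.Cat) ⊗ X ⟶ (⟨b⟩ : theory.Cat) ⊗ X}
    {q : (⟨b⟩ : theory.Cat) ⊗ X ⟶ (⟨c⟩ : theory.Cat) ⊗ X} (hf : whisker f X = p)
    (hg : whisker g X = q) : whisker (f ≫ g) X = p ≫ q := by
  rw [whisker_comp, hf, hg]

theorem whisker_tensorHom_id_heq (f : a ⟶ b) (c : Syn) (X : theory.Cat) :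
    whisker (f ⊗ₘ 𝟙 c) X ≍ whisker f (⟨c⟩ ⊗ X) := by
  rw [tensorHom_id]
  exact StrictMonoidal.whiskerRight_whiskerRight_heq
    (EqTheory.Cat.ofHom (E := theory) f) ⟨c⟩ X

theorem whisker_id_tensorHom_heq (c : Syn) (f : a ⟶ b) (X : theory.Cat) :
    whisker (𝟙 c ⊗ₘ f) X ≍ (⟨c⟩ : theory.Cat) ◁ whisker f X := by
  rw [id_tensorHom]
  exact StrictMonoidal.whisker_assoc_heq ⟨c⟩ (EqTheory.Cat.ofHom (E := theory) f) X

theorem whisker_tensorHom {c d : Syn} (f : a ⟶ b) (g : c ⟶ d) (X : theory.Cat) :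
    whisker (f ⊗ₘ g) X = whisker (f ⊗ₘ 𝟙 c) X ≫ whisker (𝟙 b ⊗ₘ g) X := by
  rw [← whisker_comp, tensorHom_comp_tensorHom, Category.comp_id, Category.id_comp]

end Whisker

theorem whisker_sides (e : Rel) (X : theory.Cat) :
    whisker (sides e).1 X = whisker (sides e).2 X :=
  congrArg (fun f : (⟨N (relSrc e)⟩ : theory.Cat) ⟶ ⟨N (relTgt e)⟩ => f ▷ X)
    (Quotient.sound (EqTheory.Congruence.rel (E := theory) e))

theorem eq_of_rel (e : Rel) {X : theory.Cat}
    {p q : (⟨N (relSrc e)⟩ : theory.Cat) ⊗ X ⟶ (⟨N (relTgt e)⟩ : theory.Cat) ⊗ X}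
    (hp : whisker (sides e).1 X = p) (hq : whisker (sides e).2 X = q) : p = q :=
  hp.symm.trans ((whisker_sides e X).trans hq)

section Tensor

theorem whisker_id_tensorHom {m n : ℕ} (f : N m ⟶ N n) (X : theory.Cat) :
    whisker (I ⊗ₘ f) X = cons.map (whisker f X) :=
  (whisker_id_tensorHom_heq (N 1) f X).eq

variable (X : theory.Cat)

theorem whisker_mu_id : whisker (μ ⊗ₘ I) X = whisker μ (cons.obj X) :=
  (whisker_tensorHom_id_heq μ (N 1) X).eq

theorem whisker_eta_id : whisker (η ⊗ₘ I) X = whisker η (cons.obj X) :=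
  (whisker_tensorHom_id_heq η (N 1) X).eq

theorem whisker_delta_id : whisker (δ ⊗ₘ I) X = whisker δ (cons.obj X) :=
  (whisker_tensorHom_id_heq δ (N 1) X).eq

theorem whisker_eps_id : whisker (ε ⊗ₘ I) X = whisker ε (cons.obj X) :=
  (whisker_tensorHom_id_heq ε (N 1) X).eq

theorem whisker_gam_id : whisker γI X = whisker γ (cons.obj X) :=
  (whisker_tensorHom_id_heq γ (N 1) X).eq

theorem whisker_id_gam : whisker Iγ X = cons.map (whisker γ X) :=
  whisker_id_tensorHom γ X

theorem whisker_id_gam_id : whisker IγI X = cons.map (whisker γ (cons.obj X)) :=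
  (whisker_tensorHom_id_heq Iγ (N 1) X).eq.trans (whisker_id_gam (cons.obj X))

theorem whisker_delta_delta : whisker (δ ⊗ₘ δ) X =
    whisker δ (cons.obj X) ≫ cons.map (cons.map (whisker δ X)) :=
  (whisker_tensorHom δ δ X).trans (congrArg₂ CategoryStruct.comp (whisker_delta_id X)
    ((whisker_id_tensorHom_heq (N 2) δ X).eq.trans (two_whiskerLeft _)))

theorem whisker_mu_mu : whisker (μ ⊗ₘ μ) X =
    whisker μ (cons.obj (cons.obj X)) ≫ cons.map (whisker μ X) :=
  (whisker_tensorHom μ μ X).trans (congrArg₂ CategoryStruct.comp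
    (whisker_tensorHom_id_heq μ (N 2) X).eq (whisker_id_tensorHom μ X))

theorem whisker_eta_eta : whisker (η ⊗ₘ η) X = whisker η X ≫ cons.map (whisker η X) :=
  (whisker_tensorHom η η X).trans (congrArg₂ CategoryStruct.comp
    (whisker_tensorHom_id_heq η (N 0) X).eq (whisker_id_tensorHom η X))

theorem whisker_eps_eps : whisker (ε ⊗ₘ ε) X = whisker ε (cons.obj X) ≫ whisker ε X :=
  (whisker_tensorHom ε ε X).trans (congrArg₂ CategoryStruct.comp (whisker_eps_id X)
    ((whisker_id_tensorHom_heq (N 0) ε X).eq.trans (zero_whiskerLeft _)))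

end Tensor

/-- The object `1`, acting by tensoring on the left, with its bialgebra structure. -/
def action : BialgebraAction theory.Cat where
  T := cons
  mul.app X := whisker μ X
  mul.naturality _ _ f :=
    (congrArg (· ≫ _) (two_whiskerLeft f).symm).trans (whisker_naturality μ f)
  one.app X := whisker η X
  one.naturality _ _ f :=
    (congrArg (· ≫ _) (zero_whiskerLeft f).symm).trans (whisker_naturality η f)
  comul.app X := whisker δ X
  comul.naturality _ _ f :=
    (whisker_naturality δ f).trans (congrArg (_ ≫ ·) (two_whiskerLeft f))
  counit.app X := whisker ε X
  counit.naturality _ _ f :=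
    (whisker_naturality ε f).trans (congrArg (_ ≫ ·) (zero_whiskerLeft f))
  swap.app X := whisker γ X
  swap.naturality _ _ f := (congrArg (· ≫ _) (two_whiskerLeft f).symm).trans
    ((whisker_naturality γ f).trans (congrArg (_ ≫ ·) (two_whiskerLeft f)))
  swap_swap X := eq_of_rel .symSym (whisker_comp_eq rfl rfl) (whisker_id _ X)
  yangBaxter X := eq_of_rel .yangBaxter
    (whisker_comp_eq (whisker_id_gam X) (whisker_comp_eq (whisker_gam_id X) (whisker_id_gam X)))
    (whisker_comp_eq (whisker_gam_id X) (whisker_comp_eq (whisker_id_gam X) (whisker_gam_id X)))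
  mul_assoc X := eq_of_rel .mulAssoc (whisker_comp_eq (whisker_mu_id X) rfl)
    (whisker_comp_eq (whisker_id_tensorHom μ X) rfl)
  one_mul X := eq_of_rel .unitMul (whisker_comp_eq (whisker_eta_id X) rfl) (whisker_id _ X)
  mul_one X := eq_of_rel .mulUnit (whisker_comp_eq (whisker_id_tensorHom η X) rfl) (whisker_id _ X)
  mul_swap X := eq_of_rel .mulNatL (whisker_comp_eq (whisker_mu_id X) rfl)
    (whisker_comp_eq (whisker_id_gam X)
      (whisker_comp_eq (whisker_gam_id X) (whisker_id_tensorHom μ X)))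
  map_mul_swap X := eq_of_rel .mulNatR (whisker_comp_eq (whisker_id_tensorHom μ X) rfl)
    (whisker_comp_eq (whisker_gam_id X) (whisker_comp_eq (whisker_id_gam X) (whisker_mu_id X)))
  map_one_swap X := eq_of_rel .unitNatR (whisker_comp_eq (whisker_id_tensorHom η X) rfl)
    (whisker_eta_id X)
  swap_mul _ := eq_of_rel .mulComm (whisker_comp_eq rfl rfl) rfl
  comul_assoc X := eq_of_rel .comulCoassoc (whisker_comp_eq rfl (whisker_delta_id X))
    (whisker_comp_eq rfl (whisker_id_tensorHom δ X))
  comul_counit X := eq_of_rel .counitComul (whisker_comp_eq rfl (whisker_eps_id X)) (whisker_id _ X)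
  comul_map_counit X := eq_of_rel .comulCounit (whisker_comp_eq rfl (whisker_id_tensorHom ε X))
    (whisker_id _ X)
  swap_comul X := eq_of_rel .comulNatL (whisker_comp_eq rfl (whisker_delta_id X))
    (whisker_comp_eq (whisker_id_tensorHom δ X)
      (whisker_comp_eq (whisker_gam_id X) (whisker_id_gam X)))
  swap_map_comul X := eq_of_rel .comulNatR (whisker_comp_eq rfl (whisker_id_tensorHom δ X))
    (whisker_comp_eq (whisker_delta_id X) (whisker_comp_eq (whisker_id_gam X) (whisker_gam_id X)))
  swap_counit X := eq_of_rel .counitNatL (whisker_comp_eq rfl (whisker_eps_id X))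
    (whisker_id_tensorHom ε X)
  swap_map_counit X := eq_of_rel .counitNatR (whisker_comp_eq rfl (whisker_id_tensorHom ε X))
    (whisker_eps_id X)
  comul_swap _ := eq_of_rel .comulComm (whisker_comp_eq rfl rfl) rfl
  mul_comul X := (eq_of_rel .mulComul (whisker_comp_eq rfl rfl)
    (whisker_comp_eq (whisker_delta_delta X)
      (whisker_comp_eq (whisker_id_gam_id X) (whisker_mu_mu X)))).trans (Category.assoc _ _ _)
  one_comul X := eq_of_rel .unitComul (whisker_comp_eq rfl rfl) (whisker_eta_eta X)
  mul_counit X := eq_of_rel .mulCounit (whisker_comp_eq rfl rfl) (whisker_eps_eps X)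
  one_counit X := eq_of_rel .unitCounit (whisker_comp_eq rfl rfl) (whisker_id _ X)

end Bialg

namespace MRel

/-- The interpretation of the signature of bialgebras in multirelations. -/
def interp : Bialg.theory.toSignature.Interp MRel where
  obj a := of a.length
  obj_nil := rfl
  obj_append _ _ := congrArg of List.length_append
  gen := interpGen

instance (m n : MRel) : DecidableEq (m ⟶ n) :=
  inferInstanceAs (DecidableEq (Matrix (Fin m.card) (Fin n.card) ℕ))

theorem interp_sides (e : Bialg.Rel) :
    interp.functor.map (Bialg.sides e).1 = interp.functor.map (Bialg.sides e).2 := by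
  cases e <;> decide

/-- The interpretation functor. -/
def interpretation : Bialg.theory.Cat ⥤ MRel :=
  EqTheory.lift (E := Bialg.theory) interp.functor_isStrictMonoidal interp_sides

theorem isInterpretation : IsInterpretation interpretation where
  strict := EqTheory.lift_isStrictMonoidal _ _
  obj _ := rfl
  map_gen _ := ((Category.id_comp _).trans (Category.comp_id _)).symm

open Matrix

/-- Concatenation of vectors whose index sets are the positions in words. -/
def join {α E : Type*} {a b : List E} (u : Fin a.length → α) (v : Fin b.length → α) :
    Fin (a ++ b).length → α :=
  fun i => Fin.append u v (Fin.cast List.length_append i)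

section Join

variable {α E : Type*} {a b : List E}

theorem join_nil (u : Fin ([] : List E).length → α) (v : Fin b.length → α) : join u v = v :=
  (congrArg (· ∘ _) (Fin.append_left_nil u v rfl)).trans rfl

theorem join_cons {x : E} (u : Fin (x :: a).length → α) (v : Fin b.length → α) :
    join u v = vecCons (u 0) (join (vecTail u) v) := by
  obtain ⟨c, u, rfl⟩ : ∃ c w, u = vecCons c w := ⟨_, _, (cons_head_tail u).symm⟩
  ext i
  refine (congrFun (Fin.append_cons c u v) (Fin.cast List.length_append i)).trans ?_
  cases i using Fin.cases <;> rfl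

theorem join_one {x : E} (r : Fin (b.length + 1) → α) :
    join (a := [x]) ![r 0] (vecTail r) = r := by
  rw [join_cons, join_nil]
  exact cons_head_tail r

theorem join_two {x y : E} (r : Fin (b.length + 2) → α) :
    join (a := [x, y]) ![r 0, r 1] (vecTail (vecTail r)) = r := by
  rw [join_cons]
  exact (congrArg (vecCons (r 0)) (join_one (vecTail r))).trans (cons_head_tail r)

end Join

theorem append_vecMul_sum {m n p q : ℕ} (R : Matrix (Fin m) (Fin n) ℕ)
    (R' : Matrix (Fin p) (Fin q) ℕ) (u : Fin m → ℕ) (v : Fin p → ℕ) :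
    Fin.append u v ᵥ* sum R R' = Fin.append (u ᵥ* R) (v ᵥ* R') := by
  ext j
  cases j using Fin.addCases <;>
    simp [Matrix.vecMul, dotProduct, Fin.sum_univ_add, sum_inl_inl, sum_inl_inr, sum_inr_inl,
      sum_inr_inr]

/-- The action on row vectors of the interpretation of a morphism. -/
def act {X Y : Bialg.theory.Cat} (f : X ⟶ Y) (v : Fin X.as.word.length → ℕ) :
    Fin Y.as.word.length → ℕ :=
  v ᵥ* coeff (interpretation.map f)

theorem act_id (X : Bialg.theory.Cat) : act (𝟙 X) = id :=
  funext fun v => (congrArg (v ᵥ* ·) (interpretation.map_id X)).trans (Matrix.vecMul_one v)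

theorem act_comp {X Y Z : Bialg.theory.Cat} {f : X ⟶ Y} {g : Y ⟶ Z}
    {φ : (Fin X.as.word.length → ℕ) → (Fin Y.as.word.length → ℕ)}
    {ψ : (Fin Y.as.word.length → ℕ) → (Fin Z.as.word.length → ℕ)} (hf : act f = φ)
    (hg : act g = ψ) : act (f ≫ g) = ψ ∘ φ := by
  subst hf hg
  exact funext fun v => (congrArg (v ᵥ* ·) (interpretation.map_comp f g)).trans
    (Matrix.vecMul_vecMul v _ _).symm

theorem coeff_map_tensorHom {X₁ Y₁ X₂ Y₂ : Bialg.theory.Cat} (f : X₁ ⟶ Y₁) (g : X₂ ⟶ Y₂) :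
    coeff (interpretation.map (f ⊗ₘ g)) =
      (sum (coeff (interpretation.map f)) (coeff (interpretation.map g))).submatrix
        (Fin.cast List.length_append) (Fin.cast List.length_append) := by
  ext i j
  rw [isInterpretation.strict.tensor_map, coeff_eqToHom_comp, coeff_comp_eqToHom]
  rfl

theorem act_tensorHom {X₁ Y₁ X₂ Y₂ : Bialg.theory.Cat} (f : X₁ ⟶ Y₁) (g : X₂ ⟶ Y₂)
    (u : Fin X₁.as.word.length → ℕ) (v : Fin X₂.as.word.length → ℕ) :
    act (f ⊗ₘ g) (join u v) = join (act f u) (act g v) := by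
  refine (congrArg (join u v ᵥ* ·) (coeff_map_tensorHom f g)).trans ?_
  refine (submatrix_vecMul_equiv _ (join u v) (finCongr List.length_append) _).trans ?_
  exact congrArg (· ∘ Fin.cast List.length_append) (append_vecMul_sum _ _ u v)

end MRel

namespace Bialg

open Matrix MRel

theorem act_cons {X Y : theory.Cat} {f : X ⟶ Y}
    {φ : (Fin X.as.word.length → ℕ) → (Fin Y.as.word.length → ℕ)} (hf : act f = φ) :
    act (cons.map f) =
      fun r : Fin (X.as.word.length + 1) → ℕ => vecCons (r 0) (φ (vecTail r)) := by
  funext (r : Fin (X.as.word.length + 1) → ℕ)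
  have act_id_tensor := act_tensorHom (𝟙 (⟨N 1⟩ : theory.Cat)) f ![r 0] (vecTail r)
  rw [act_id, id_tensorHom, hf] at act_id_tensor
  exact ((congrArg _ (join_one r)).symm.trans act_id_tensor).trans
    (join_one (vecCons (r 0) (φ (vecTail r))))

theorem act_gen_whiskerRight {x : Gen} {X : theory.Cat}
    {u : Fin (theory.s₁ x).length → ℕ} {u' : Fin (theory.t₁ x).length → ℕ}
    {v : Fin X.as.word.length → ℕ} {r : Fin (theory.s₁ x ++ X.as.word).length → ℕ}
    {r' : Fin (theory.t₁ x ++ X.as.word).length → ℕ} (hr : join u v = r) (hr' : join u' v = r')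
    (hu : u ᵥ* coeff (interpGen x) = u') : act (EqTheory.Cat.gen theory x ▷ X) r = r' := by
  have act_tensor_id := act_tensorHom (EqTheory.Cat.gen theory x) (𝟙 X) u v
  rw [act_id, tensorHom_id] at act_tensor_id
  rw [← hr, ← hr', ← hu]
  exact act_tensor_id

section Generators

variable (X : theory.Cat)

theorem act_mul : act (action.mul.app X) =
    fun r : Fin (X.as.word.length + 2) → ℕ => vecCons (r 0 + r 1) (vecTail (vecTail r)) := by
  funext (r : Fin (X.as.word.length + 2) → ℕ)
  have row_mul : ![r 0, r 1] ᵥ* (!![1; 1] : Matrix (Fin 2) (Fin 1) ℕ) = ![r 0 + r 1] := by simp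
  exact act_gen_whiskerRight (x := .mu) (join_two r)
    (join_one (vecCons (r 0 + r 1) (vecTail (vecTail r)))) row_mul

theorem act_one : act (action.one.app X) = vecCons 0 := by
  funext (v : Fin X.as.word.length → ℕ)
  have row_zero : ![] ᵥ* (0 : Matrix (Fin 0) (Fin 1) ℕ) = ![0] := by
    ext; simp
  exact act_gen_whiskerRight (x := .eta) (join_nil ![] v) (join_one (vecCons 0 v)) row_zero

theorem act_comul : act (action.comul.app X) =
    fun r : Fin (X.as.word.length + 1) → ℕ => vecCons (r 0) r := by
  funext (r : Fin (X.as.word.length + 1) → ℕ)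
  have row_comul : ![r 0] ᵥ* (!![1, 1] : Matrix (Fin 1) (Fin 2) ℕ) = ![r 0, r 0] := by simp
  exact act_gen_whiskerRight (x := .delta) (join_one r) (join_two (vecCons _ r)) row_comul

theorem act_counit : act (action.counit.app X) =
    (vecTail : (Fin (X.as.word.length + 1) → ℕ) → Fin X.as.word.length → ℕ) := by
  funext (r : Fin (X.as.word.length + 1) → ℕ)
  exact act_gen_whiskerRight (x := .eps) (join_one r) (join_nil _ _) rfl

theorem act_swap : act (action.swap.app X) = fun r : Fin (X.as.word.length + 2) → ℕ =>
    vecCons (r 1) (vecCons (r 0) (vecTail (vecTail r))) := by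
  funext (r : Fin (X.as.word.length + 2) → ℕ)
  have row_swap : ![r 0, r 1] ᵥ* (!![0, 1; 1, 0] : Matrix (Fin 2) (Fin 2) ℕ) = ![r 1, r 0] := by
    simp
  exact act_gen_whiskerRight (x := .gam) (join_two r)
    (join_two (vecCons (r 1) (vecCons (r 0) (vecTail (vecTail r))))) row_swap

end Generators

open BialgebraAction Power

/-- A word, seen as a tensor power of the object `1`. -/
def wordPower : ∀ w : List Unit, action.Power (𝟙_ theory.Cat) w.length ⟨⟨w⟩⟩
  | [] => .zero
  | _ :: w => .succ (wordPower w)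

theorem intertwines_gen (x : Gen) (Z : theory.Cat) :
    Intertwines (wordPower (theory.s₁ x ++ Z.as.word)) (wordPower (theory.t₁ x ++ Z.as.word))
      (EqTheory.Cat.gen theory x ▷ Z) (act (EqTheory.Cat.gen theory x ▷ Z)) :=
  match x with
  | .mu => act_mul Z ▸ Intertwines.mul (wordPower Z.as.word)
  | .eta => act_one Z ▸ Intertwines.one (wordPower Z.as.word)
  | .delta => act_comul Z ▸ Intertwines.comul (wordPower Z.as.word)
  | .eps => act_counit Z ▸ Intertwines.counit (wordPower Z.as.word)
  | .gam => act_swap Z ▸ Intertwines.swap (wordPower Z.as.word)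

theorem intertwines_act {X Y : theory.Cat} (f : X ⟶ Y) :
    Intertwines (wordPower X.as.word) (wordPower Y.as.word) f (act f) := by
  let P : MorphismProperty theory.Cat := fun X Y f =>
    Intertwines (wordPower X.as.word) (wordPower Y.as.word) f (act f)
  have : P.IsMultiplicative :=
    { id_mem X := show Intertwines _ _ _ _ by rw [act_id]; exact .id _
      comp_mem f g hf hg := show Intertwines _ _ _ _ by rw [act_comp rfl rfl]; exact hf.comp hg }
  exact EqTheory.Cat.hom_induction (P := P)
    (fun _ _ _ _ hf => show Intertwines _ _ _ _ from act_cons rfl ▸ hf.map) intertwines_gen f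

theorem act_pass (k : ℕ) (X : theory.Cat) : act (action.pass k X) =
    fun r : Fin (X.as.word.length + 2) → ℕ =>
      vecCons (r 1 + k * r 0) (vecCons (r 0) (vecTail (vecTail r))) := by
  induction k with
  | zero =>
    simp only [Nat.zero_mul, Nat.add_zero]
    exact act_swap X
  | succ k ih =>
    refine (act_comp (act_comul (cons.obj X))
      (act_comp (act_cons ih) (act_mul (cons.obj X)))).trans ?_
    refine funext fun r : Fin (X.as.word.length + 2) → ℕ => congrArg (vecCons · _) ?_
    change r 0 + (r 1 + k * r 0) = r 1 + (k + 1) * r 0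
    ring

theorem act_row (w : List Unit) (r : Fin w.length → ℕ) : act ((wordPower w).row r) =
    fun v : Fin (w.length + 1) → ℕ => vecTail v + v 0 • r := by
  induction w with
  | nil => exact funext fun _ => Subsingleton.elim (α := Fin 0 → ℕ) _ _
  | cons _ w ih =>
    refine (act_comp (act_pass (r 0) ⟨⟨w⟩⟩) (act_cons (ih (vecTail r)))).trans ?_
    refine funext fun v : Fin (w.length + 2) → ℕ => funext <| Fin.cases ?_ fun _ => rfl
    exact congrArg (v 1 + ·) (Nat.mul_comm (r 0) (v 0))

theorem act_unit (w : List Unit) : act (wordPower w).unit = 0 := by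
  induction w with
  | nil => exact funext fun _ => Subsingleton.elim (α := Fin 0 → ℕ) _ _
  | cons _ w ih =>
    refine (act_comp ih (act_one ⟨⟨w⟩⟩)).trans (funext fun _ => ?_)
    exact cons_zero_zero

theorem act_mat (w z : List Unit) (R : Fin w.length → Fin z.length → ℕ) :
    act ((wordPower z).mat (wordPower w) R) = (· ᵥ* Matrix.of R) := by
  induction w with
  | nil => exact (act_unit z).trans (funext fun v => (empty_vecMul v (Matrix.of R)).symm)
  | cons _ w ih =>
    refine (act_comp (act_cons (ih (vecTail R))) (act_row z (R 0))).trans ?_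
    refine funext fun v : Fin (w.length + 1) → ℕ => (add_comm _ _).trans ?_
    refine (cons_vecMul (v 0) (vecTail v) (Matrix.of R)).symm.trans ?_
    exact congrArg (· ᵥ* Matrix.of R) (cons_head_tail v)

instance : interpretation.Full where
  map_surjective {X Y} R := ⟨(wordPower Y.as.word).mat (wordPower X.as.word) R,
    Matrix.ext_of_single_vecMul fun i => congrFun (act_mat X.as.word Y.as.word R) (Pi.single i 1)⟩

theorem mat_interpretation_map {X Y : theory.Cat} (f : X ⟶ Y) :
    (wordPower Y.as.word).mat (wordPower X.as.word) (interpretation.map f) = f := by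
  refine .trans (congrArg _ (funext fun i => ?_)) (intertwines_act f).eq_mat.symm
  exact (single_one_vecMul i (coeff (interpretation.map f))).symm

instance : interpretation.Faithful where
  map_injective {X Y f g} h := by
    rw [← mat_interpretation_map f, h, mat_interpretation_map]

end Bialg

section StrictFunctors

variable {C : Type u} [Category.{v} C] [MonoidalCategory C]
variable {D : Type u₁} [Category.{v₁} D] [MonoidalCategory D]

theorem eqToHom_tensorHom_eqToHom {X Y X' Y' : C} (h : X = Y) (h' : X' = Y') :
    eqToHom h ⊗ₘ eqToHom h' = eqToHom (congrArg₂ (· ⊗ ·) h h') := by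
  subst h h'; simp

theorem isMonoidalTrans_eqToHom {F G : C ⥤ D} (hF : IsStrictMonoidal F) (hG : IsStrictMonoidal G)
    (h : F = G) : IsMonoidalTrans hF hG (eqToHom h) where
  unit_app := eqToHom_app h _
  tensor_app X Y := by
    simp [eqToHom_app, eqToHom_tensorHom_eqToHom]

theorem IsStrictMonoidal.map_tensorHom_heq {F : C ⥤ D} (hF : IsStrictMonoidal F)
    {X₁ Y₁ X₂ Y₂ : C} (f : X₁ ⟶ Y₁) (g : X₂ ⟶ Y₂) : F.map (f ⊗ₘ g) ≍ F.map f ⊗ₘ F.map g :=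
  (conj_eqToHom_iff_heq' _ _ (hF.tensor_obj _ _) (hF.tensor_obj _ _).symm).1 (hF.tensor_map f g)

theorem monoidallyEquivalent_of_inverse {F : C ⥤ D} {G : D ⥤ C} (hF : IsStrictMonoidal F)
    (hG : IsStrictMonoidal G) (h : F ⋙ G = 𝟭 C) (h' : G ⋙ F = 𝟭 D) : MonoidallyEquivalent C D :=
  ⟨F, G, hF, hG, eqToIso h.symm, eqToIso h', isMonoidalTrans_eqToHom _ _ h.symm,
    isMonoidalTrans_eqToHom _ _ h'⟩

end StrictFunctors

section InverseOfObj

theorem heq_of_map_heq {C : Type u} [Category.{v} C] {D : Type u₁} [Category.{v₁} D] (F : C ⥤ D)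
    [F.Faithful] {X Y X' Y' : C} (hX : X = X') (hY : Y = Y') {f : X ⟶ Y} {g : X' ⟶ Y'}
    (h : F.map f ≍ F.map g) : f ≍ g := by
  subst hX hY
  exact heq_of_eq (F.map_injective (eq_of_heq h))

variable {C : Type u} [Category.{v} C] {D : Type u₁} [Category.{v₁} D] (F : C ⥤ D) [F.Full]
  [F.Faithful] {o : D → C} (obj_o : ∀ Y, F.obj (o Y) = Y)

/-- The inverse, given by `o` on objects, of a fully faithful functor that is bijective on
objects. -/
noncomputable def inverseOfObj : D ⥤ C where
  obj := o
  map {X Y} f := F.preimage (eqToHom (obj_o X) ≫ f ≫ eqToHom (obj_o Y).symm)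
  map_id _ := F.map_injective (by simp)
  map_comp _ _ := F.map_injective (by simp)

theorem map_inverseOfObj_map_heq {X Y : D} (f : X ⟶ Y) :
    F.map ((inverseOfObj F obj_o).map f) ≍ f :=
  (conj_eqToHom_iff_heq' _ _ (obj_o X) (obj_o Y).symm).1 (F.map_preimage _)

theorem inverseOfObj_comp : inverseOfObj F obj_o ⋙ F = 𝟭 D :=
  Functor.hext obj_o fun _ _ f => map_inverseOfObj_map_heq F obj_o f

theorem comp_inverseOfObj (o_obj : ∀ X, o (F.obj X) = X) : F ⋙ inverseOfObj F obj_o = 𝟭 C :=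
  Functor.hext o_obj fun X Y f =>
    heq_of_map_heq F (o_obj X) (o_obj Y) (map_inverseOfObj_map_heq F obj_o (F.map f))

variable {F} [MonoidalCategory C] [MonoidalCategory D]

theorem IsStrictMonoidal.inverseOfObj (hF : IsStrictMonoidal F)
    (o_obj : ∀ X, o (F.obj X) = X) : IsStrictMonoidal (inverseOfObj F obj_o) := by
  have o_tensor (X Y : D) : o (X ⊗ Y) = o X ⊗ o Y := by
    rw [← o_obj (o X ⊗ o Y), hF.tensor_obj, obj_o, obj_o]
  refine ⟨(congrArg o hF.unit_obj).symm.trans (o_obj _), o_tensor, fun f g => ?_⟩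
  refine (conj_eqToHom_iff_heq' _ _ (o_tensor _ _) (o_tensor _ _).symm).2 ?_
  refine heq_of_map_heq F (o_tensor _ _) (o_tensor _ _) ?_
  refine (map_inverseOfObj_map_heq F obj_o (f ⊗ₘ g)).trans
    (.trans ?_ (hF.map_tensorHom_heq _ _).symm)
  exact tensorHom_heq (obj_o _).symm (obj_o _).symm (obj_o _).symm (obj_o _).symm
    (map_inverseOfObj_map_heq F obj_o f).symm (map_inverseOfObj_map_heq F obj_o g).symm

end InverseOfObj

theorem mainTheorem2 :
    (∃ (F : Bialg.theory.Cat ⥤ MRel) (G : MRel ⥤ Bialg.theory.Cat),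
      IsInterpretation F ∧ IsStrictMonoidal G ∧ F ⋙ G = 𝟭 Bialg.theory.Cat ∧ G ⋙ F = 𝟭 MRel) ∧
    Bialg.theory.IsPresentation MRel := by
  let word (n : MRel) : Bialg.theory.Cat := ⟨⟨List.replicate n.card ()⟩⟩
  have obj_word (n : MRel) : MRel.interpretation.obj (word n) = n :=
    congrArg MRel.of List.length_replicate
  have word_obj (X : Bialg.theory.Cat) : word (MRel.interpretation.obj X) = X :=
    congrArg (fun w => (⟨⟨w⟩⟩ : Bialg.theory.Cat))
      (List.eq_replicate_iff.mpr ⟨rfl, fun _ _ => rfl⟩).symm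
  have strict := MRel.isInterpretation.strict
  have strict_inverse := IsStrictMonoidal.inverseOfObj obj_word strict word_obj
  have comp_inverse := comp_inverseOfObj MRel.interpretation obj_word word_obj
  have inverse_comp := inverseOfObj_comp MRel.interpretation obj_word
  exact ⟨⟨_, _, MRel.isInterpretation, strict_inverse, comp_inverse, inverse_comp⟩,
    monoidallyEquivalent_of_inverse strict_inverse strict inverse_comp comp_inverse⟩
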